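/- Let $\lambda>0$, $\mu>0$, $0<e<1$ and $a=\lambda^2/\mu$. The Keplerian dynamical system is the planar system $\dot{\vec x}=\vec b(\vec x)$, $\vec b=(b_x,b_y)$, with \[ b_x=\frac{\mu}{2\lambda}\Big\{(\alpha+\beta-1)\frac1e-(\alpha+\beta+1)\frac{x}{\sqrt{x^2+y^2}}\Big\},\qquad b_y=\frac{\mu}{2\lambda}\Big\{(\alpha-\beta-1)\frac{\sqrt{1-e^2}}{e}-(\alpha+\beta+1)\frac{y}{\sqrt{x^2+y^2}}\Big\}, \] where, with $r=\sqrt{x^2+y^2}$ and $D=(er-x)^2+(1-e^2)y^2$, \[ \alpha=\left(\frac12\sqrt{\frac{(er-x-4\lambda^2e/\mu)^2+(1-e^2)y^2}{D}}+\frac12\,\frac{(er-x-2\lambda^2e/\mu)^2+(1-e^2)y^2-4\lambda^4e^2/\mu^2}{D}\right)^{1/2},\qquad \beta=\frac{-2\lambda^2e\sqrt{1-e^2}\,y}{\mu D\alpha}. \] Its phase space is the plane without the singular segment $\{(x,0):-\frac{4ae}{1+e}\le x\le 0\}$. Let $\mathcal E_e$ be the Kepler ellipse, given in polar coordinates by $r=\dfrac{a(1-e^2)}{1+e\cos\theta}$.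 Write $d(\vec x,\mathcal E_e)=\inf_{\vec y\in\mathcal E_e}|\vec x-\vec y|$, and write $\vec x(t;\vec x_0,t_0)$ for the solution with value $\vec x_0$ at time $t_0$. Then $\mathcal E_e$ is an asymptotically orbitally stable periodic orbit of the Keplerian dynamical system. That is: (i) there is a non-constant periodic solution, defined for all times, whose trace is exactly $\mathcal E_e$; (ii) for every $\delta_1>0$, every $t_0$ and every $\vec x_0$ which is the value at time $t_0$ of a periodic solution traversing $\mathcal E_e$, there is $\delta_2>0$ such that for all $\tilde{\vec x}_0$ with $|\tilde{\vec x}_0-\vec x_0|<\delta_2$ the solution $\vec x(t;\tilde{\vec x}_0,t_0)$ exists in the phase space for all $t\ge t_0$, is unique, and satisfies $d(\vec x(t;\tilde{\vec x}_0,t_0),\mathcal E_e)<\delta_1$ for all $t>t_0$; (iii) for every such $t_0$ and $\vec x_0$ there is $\delta_3>0$ such that for all $\tilde{\vec x}_0$ with $|\tilde{\vec x}_0-\vec x_0|<\delta_3$ the solution $\vec x(t;\tilde{\vec x}_0,t_0)$ exists in the phase space for all $t\ge t_0$, is unique, and satisfies $\lim_{t\to\infty}d(\vec x(t;\tilde{\vec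 x}_0,t_0),\mathcal E_e)=0$. -/

import Mathlib

open Set Filter Topology

noncomputable section

/-! ### Trajectories and orbital stability of an autonomous planar system -/

/-- The Euclidean plane. -/
abbrev Plane : Type := EuclideanSpace ℝ (Fin 2)

/-- `x` solves `ẋ = b(x)` on the time set `I`, staying in the region `U` where `b` is defined
(the derivative at an end point that belongs to `I` is the one-sided one). -/
def IsSolutionOn (b : Plane → Plane) (U : Set Plane) (I : Set ℝ) (x : ℝ → Plane) : Prop :=
  ∀ t ∈ I, x t ∈ U ∧ HasDerivWithinAt x (b (x t)) I t

/-- `x` is the trajectory `t ↦ x(t; x₀, t₀)`, `t ≥ t₀`: it solves the system on `[t₀, ∞)`, starts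
at `x₀` at time `t₀`, and any solution on some `[t₀, T)` with the same initial value agrees with
it there. -/
structure IsTrajectory (b : Plane → Plane) (U : Set Plane) (t₀ : ℝ) (x₀ : Plane)
    (x : ℝ → Plane) : Prop where
  isSolution : IsSolutionOn b U (Ici t₀) x
  initial : x t₀ = x₀
  unique : ∀ (T : ℝ) (y : ℝ → Plane),
    IsSolutionOn b U (Ico t₀ T) y → y t₀ = x₀ → EqOn y x (Ico t₀ T)

/-- `x` is a (non-constant) periodic solution, defined for all times, whose trace is `C`. -/
structure IsPeriodicSolutionTraversing (b : Plane → Plane) (U : Set Plane) (C : Set Plane)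
    (x : ℝ → Plane) : Prop where
  isSolution : IsSolutionOn b U univ x
  periodic : ∃ T : ℝ, 0 < T ∧ Function.Periodic x T
  nonconstant : ∃ s t : ℝ, x s ≠ x t
  range_eq : range x = C

/-- `C` is the closed trajectory of a periodic orbit of `ẋ = b(x)`. -/
def IsPeriodicOrbit (b : Plane → Plane) (U : Set Plane) (C : Set Plane) : Prop :=
  ∃ x : ℝ → Plane, IsPeriodicSolutionTraversing b U C x

/-- Orbital stability of the closed trajectory `C`. -/
def IsOrbitallyStable (b : Plane → Plane) (U : Set Plane) (C : Set Plane) : Prop :=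
  ∀ δ₁ : ℝ, 0 < δ₁ → ∀ (t₀ : ℝ) (x₀ : Plane),
    (∃ p : ℝ → Plane, IsPeriodicSolutionTraversing b U C p ∧ p t₀ = x₀) →
    ∃ δ₂ : ℝ, 0 < δ₂ ∧ ∀ x₁ : Plane, ‖x₁ - x₀‖ < δ₂ →
      ∃ x : ℝ → Plane, IsTrajectory b U t₀ x₁ x ∧
        ∀ t : ℝ, t₀ < t → Metric.infDist (x t) C < δ₁

/-- Asymptotic orbital stability of the closed trajectory `C`. -/
def IsAsymptoticallyOrbitallyStable (b : Plane → Plane) (U : Set Plane) (C : Set Plane) : Prop :=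
  IsOrbitallyStable b U C ∧
  ∀ (t₀ : ℝ) (x₀ : Plane),
    (∃ p : ℝ → Plane, IsPeriodicSolutionTraversing b U C p ∧ p t₀ = x₀) →
    ∃ δ₃ : ℝ, 0 < δ₃ ∧ ∀ x₁ : Plane, ‖x₁ - x₀‖ < δ₃ →
      ∃ x : ℝ → Plane, IsTrajectory b U t₀ x₁ x ∧
        Tendsto (fun t => Metric.infDist (x t) C) atTop (𝓝 0)

/-! ### The Keplerian dynamical system

Parameters: `lam > 0` (the constant `λ`), the force constant `mu > 0`, the eccentricity
`0 < e < 1`. -/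

/-- The semi-major axis `a = λ² / μ`. -/
def kepA (lam mu : ℝ) : ℝ := lam ^ 2 / mu

/-- The common denominator `(e √(x² + y²) - x)² + (1 - e²) y²` of `α` and `β`. -/
def kepDen (e x y : ℝ) : ℝ :=
  (e * √(x ^ 2 + y ^ 2) - x) ^ 2 + (1 - e ^ 2) * y ^ 2

/-- The function `α`. -/
def kepAlpha (lam mu e x y : ℝ) : ℝ :=
  √(1 / 2 * √(((e * √(x ^ 2 + y ^ 2) - x - 4 * lam ^ 2 * e / mu) ^ 2 + (1 - e ^ 2) * y ^ 2)
        / kepDen e x y)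
    + 1 / 2 * (((e * √(x ^ 2 + y ^ 2) - x - 2 * lam ^ 2 * e / mu) ^ 2 + (1 - e ^ 2) * y ^ 2
        - 4 * lam ^ 4 * e ^ 2 / mu ^ 2) / kepDen e x y))

/-- The function `β`. -/
def kepBeta (lam mu e x y : ℝ) : ℝ :=
  (-2 * lam ^ 2 * e * √(1 - e ^ 2) * y) / (mu * kepDen e x y * kepAlpha lam mu e x y)

/-- The component `b_x` of the drift. -/
def kepDriftX (lam mu e x y : ℝ) : ℝ :=
  mu / (2 * lam) *
    ((kepAlpha lam mu e x y + kepBeta lam mu e x y - 1) * (1 / e)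
      - (kepAlpha lam mu e x y + kepBeta lam mu e x y + 1) * (x / √(x ^ 2 + y ^ 2)))

/-- The component `b_y` of the drift. -/
def kepDriftY (lam mu e x y : ℝ) : ℝ :=
  mu / (2 * lam) *
    ((kepAlpha lam mu e x y - kepBeta lam mu e x y - 1) * (√(1 - e ^ 2) / e)
      - (kepAlpha lam mu e x y + kepBeta lam mu e x y + 1) * (y / √(x ^ 2 + y ^ 2)))

/-- The drift field `b = (b_x, b_y)` of the Keplerian dynamical system. -/
def kepDrift (lam mu e : ℝ) (p : Plane) : Plane :=
  !₂[kepDriftX lam mu e (p 0) (p 1), kepDriftY lam mu e (p 0) (p 1)]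

/-- The segment on the `x`-axis from `-4ae/(1+e)` to `0`, on which the drift is singular
(both end points, where a denominator in the drift vanishes as well, are included). -/
def kepSingularity (lam mu e : ℝ) : Set Plane :=
  {p | p 1 = 0 ∧ -(4 * kepA lam mu * e / (1 + e)) ≤ p 0 ∧ p 0 ≤ 0}

/-- The phase space: the plane without the singularity. -/
def kepDomain (lam mu e : ℝ) : Set Plane := (kepSingularity lam mu e)ᶜ

/-- The Kepler ellipse `r = a (1 - e²) / (1 + e cos θ)`, in polar coordinates. -/
def keplerEllipse (lam mu e : ℝ) : Set Plane :=
  {p | ∃ r θ : ℝ, r = kepA lam mu * (1 - e ^ 2) / (1 + e * Real.cos θ) ∧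
    p = !₂[r * Real.cos θ, r * Real.sin θ]}

end

noncomputable section

/-! Put `w = (er - x) - i√(1-e²) y`. Then `|w| = r - ex`, and `Z = α + iβ` is the square root of `1
- 4ae/w` with positive real part; the singular segment is `w ∈ [0, 4ae]`. Writing `Z = (ζ+e)/(ζ-e)`
uniformises the root: `w = -a(ζ-e)²/ζ`, and `Re Z > 0` means `|ζ| > e`. So `ζ` is a global
coordinate on the phase space. On the ellipse `ζ = exp(iE)` with `E` the eccentric anomaly, so the
ellipse becomes the unit circle (`keplerEllipse_eq_image`).

With `P = ζ/(ζ+e)` and `k = μ/(λr)` the system becomes `ζ' = kζ(i + (1+i)(1/|ζ| - 1)P)`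
(`focalField_joukowski`, `hasDerivWithinAt_ofAnomaly`). On the circle this is `E' = μ/(λr)` with `r
= a(1 - e cos E)`, which Kepler's equation integrates; this is the periodic solution.

Near the circle `|ζ| - 1` has linearised rate `-k Re((1+i)P)`, whose sign is not constant when `e >
1/√2`. But `k Re(iP)` is the derivative of `log |ζ+e|` along the circle, so the weighted function `V
= (|ζ|²-1)²|ζ+e|²` has logarithmic derivative `-2k Re P < 0` there (`lyapunovRate_neg`). By
compactness this stays below some `-κ < 0` on an annulus. Small sublevel sets of `V` therefore trap
solutions, and `V` decays exponentially (`exists_anomaly_solution`); continuity of the coordinate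
change carries this back to the plane. -/

/-- The complex coordinate `(e r - x) - i √(1 - e²) y` of a point of the plane. -/
def focalCoord (e : ℝ) (p : Plane) : ℂ :=
  ⟨e * √(p 0 ^ 2 + p 1 ^ 2) - p 0, -(√(1 - e ^ 2) * p 1)⟩

/-- The distance to the origin, in terms of the focal coordinate. -/
def focalRadius (e : ℝ) (w : ℂ) : ℝ := (‖w‖ - e * w.re) / (1 - e ^ 2)

/-- The point of the plane with a given focal coordinate. -/
def ofFocal (e : ℝ) (w : ℂ) : Plane :=
  !₂[e * focalRadius e w - w.re, -w.im / √(1 - e ^ 2)]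

/-- The focal coordinate as a (Joukowski) function of the complexified exponential of the
eccentric anomaly. -/
def joukowski (a e : ℝ) (ζ : ℂ) : ℂ := -a * (ζ - e) ^ 2 / ζ

/-- The point of the plane with (complexified exponential of the) eccentric anomaly `ζ`. -/
def ofAnomaly (a e : ℝ) (ζ : ℂ) : Plane := ofFocal e (joukowski a e ζ)

/-- The complex number `α + i β`. -/
def kepZ (lam mu e : ℝ) (p : Plane) : ℂ :=
  ⟨kepAlpha lam mu e (p 0) (p 1), kepBeta lam mu e (p 0) (p 1)⟩

/-- The complexified exponential of the eccentric anomaly of a point of the phase space. -/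
def anomaly (lam mu e : ℝ) (p : Plane) : ℂ :=
  e * (kepZ lam mu e p + 1) / (kepZ lam mu e p - 1)


section

variable {lam mu e : ℝ}

/-! ### The focal coordinate and its inverse. -/

lemma one_sub_sq_pos (he0 : 0 < e) (he1 : e < 1) : 0 < 1 - e ^ 2 := by nlinarith

lemma focalRadius_nonneg (he0 : 0 < e) (he1 : e < 1) (w : ℂ) : 0 ≤ focalRadius e w := by
  have h1 := one_sub_sq_pos he0 he1
  have h2 := Complex.re_le_norm w
  have h3 := norm_nonneg w
  exact div_nonneg (by nlinarith) h1.le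

lemma focalRadius_pos (he0 : 0 < e) (he1 : e < 1) {w : ℂ} (hw : w ≠ 0) :
    0 < focalRadius e w := by
  have h1 := one_sub_sq_pos he0 he1
  have h2 := Complex.re_le_norm w
  have h3 := norm_pos_iff.2 hw
  exact div_pos (by nlinarith) h1

lemma norm_sq_eq_re_im (w : ℂ) : ‖w‖ ^ 2 = w.re ^ 2 + w.im ^ 2 := by
  rw [Complex.sq_norm, Complex.normSq_apply]; ring

lemma sqrt_ofFocal (he0 : 0 < e) (he1 : e < 1) (w : ℂ) :
    √(ofFocal e w 0 ^ 2 + ofFocal e w 1 ^ 2) = focalRadius e w := by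
  have h1 := one_sub_sq_pos he0 he1
  have hs : √(1 - e ^ 2) ^ 2 = 1 - e ^ 2 := Real.sq_sqrt h1.le
  have hM := norm_sq_eq_re_im w
  rw [← Real.sqrt_sq (focalRadius_nonneg he0 he1 w)]
  congr 1
  simp only [ofFocal, PiLp.toLp_apply, Matrix.cons_val_zero, Matrix.cons_val_one, div_pow, hs,
    neg_sq]
  have hr : focalRadius e w * (1 - e ^ 2) = ‖w‖ - e * w.re := div_mul_cancel₀ _ h1.ne'
  field_simp
  linear_combination -hM - (focalRadius e w * (1 - e ^ 2) + ‖w‖ + e * w.re) * hr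

lemma focalCoord_ofFocal (he0 : 0 < e) (he1 : e < 1) (w : ℂ) :
    focalCoord e (ofFocal e w) = w := by
  have h1 := one_sub_sq_pos he0 he1
  have hs := (Real.sqrt_pos.2 h1).ne'
  apply Complex.ext
  · simp only [focalCoord, sqrt_ofFocal he0 he1]
    simp [ofFocal]
  · simp [focalCoord, ofFocal]
    field_simp

/-- Expanding `|w|²` with `x² + y² = r²` gives the perfect square `(r - ex)²`, and `r - ex ≥ 0`
because `|x| ≤ r` and `e < 1`. Hence `r` is linear in `|w|` and `Re w`, which makes `w` invertible.
-/
lemma norm_focalCoord (he0 : 0 < e) (he1 : e < 1) (p : Plane) :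
    ‖focalCoord e p‖ = √(p 0 ^ 2 + p 1 ^ 2) - e * p 0 := by
  have h1 := one_sub_sq_pos he0 he1
  have hs : √(1 - e ^ 2) ^ 2 = 1 - e ^ 2 := Real.sq_sqrt h1.le
  have hr : √(p 0 ^ 2 + p 1 ^ 2) ^ 2 = p 0 ^ 2 + p 1 ^ 2 := Real.sq_sqrt (by positivity)
  have hx : |p 0| ≤ √(p 0 ^ 2 + p 1 ^ 2) := Real.abs_le_sqrt (by nlinarith [sq_nonneg (p 1)])
  have h0 := Real.sqrt_nonneg (p 0 ^ 2 + p 1 ^ 2)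
  have h2 : 0 ≤ √(p 0 ^ 2 + p 1 ^ 2) - e * p 0 := by
    have := le_abs_self (p 0)
    nlinarith [abs_nonneg (p 0)]
  rw [← abs_of_nonneg (norm_nonneg _), ← abs_of_nonneg h2, ← sq_eq_sq_iff_abs_eq_abs,
    norm_sq_eq_re_im]
  simp only [focalCoord]
  linear_combination (e ^ 2 - 1) * hr + p 1 ^ 2 * hs

lemma ofFocal_focalCoord (he0 : 0 < e) (he1 : e < 1) (p : Plane) :
    ofFocal e (focalCoord e p) = p := by
  have h1 := one_sub_sq_pos he0 he1
  have hs := (Real.sqrt_pos.2 h1).ne'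
  have hr : focalRadius e (focalCoord e p) = √(p 0 ^ 2 + p 1 ^ 2) := by
    rw [focalRadius, norm_focalCoord he0 he1, div_eq_iff h1.ne']
    simp only [focalCoord]
    ring
  ext i
  fin_cases i
  · simp [ofFocal, hr]
    simp [focalCoord]
  · simp [ofFocal, focalCoord]
    field_simp

/-- On the axis `y = 0`, `w = e|x| - x` is `(1+e)|x|` for `x ≤ 0` and negative for `x > 0`. -/
lemma mem_kepDomain_iff (he0 : 0 < e) (he1 : e < 1) (p : Plane) :
    p ∈ kepDomain lam mu e ↔
      ¬ ((focalCoord e p).im = 0 ∧ 0 ≤ (focalCoord e p).re ∧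
        (focalCoord e p).re ≤ 4 * kepA lam mu * e) := by
  have hs := (Real.sqrt_pos.2 (one_sub_sq_pos he0 he1)).ne'
  rw [kepDomain, mem_compl_iff, not_iff_not]
  simp only [kepSingularity, mem_ofPred_eq, focalCoord, neg_eq_zero, mul_eq_zero, hs, false_or]
  refine and_congr_right fun hy => ?_
  rw [hy, zero_pow two_ne_zero, add_zero, Real.sqrt_sq_eq_abs, neg_le, le_div_iff₀ (by linarith)]
  rcases abs_cases (p 0) with ⟨h, h'⟩ | ⟨h, h'⟩ <;> rw [h] <;>
    constructor <;> rintro ⟨h2, h3⟩ <;> constructor <;> nlinarith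

/-! ### `α + iβ` as a complex square root. -/

/-- A square root `Z` of `1 - 4 a e / w` with positive real part is `α + i β`. -/
lemma kepZ_eq (hmu : 0 < mu) (he0 : 0 < e) (he1 : e < 1)
    {p : Plane} {Z : ℂ} (hw : focalCoord e p ≠ 0)
    (hZ : Z ^ 2 * focalCoord e p = focalCoord e p - 4 * kepA lam mu * e) (hre : 0 < Z.re) :
    kepZ lam mu e p = Z := by
  have h1 := one_sub_sq_pos he0 he1
  have hs : √(1 - e ^ 2) ^ 2 = 1 - e ^ 2 := Real.sq_sqrt h1.le
  set w := focalCoord e p with hwdef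
  have hD : 0 < w.re ^ 2 + w.im ^ 2 := by
    rw [← norm_sq_eq_re_im]; exact pow_pos (norm_pos_iff.2 hw) 2
  obtain ⟨X, Y⟩ := Z
  have e1 := congrArg Complex.re hZ
  have e2 := congrArg Complex.im hZ
  simp [pow_two] at e1 e2 hre
  have wre : w.re = e * √(p 0 ^ 2 + p 1 ^ 2) - p 0 := rfl
  have wim : w.im = -(√(1 - e ^ 2) * p 1) := rfl
  have hden : kepDen e (p 0) (p 1) = w.re ^ 2 + w.im ^ 2 := by
    rw [kepDen, wre, wim, neg_sq, mul_pow, hs]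
  have hc : 4 * kepA lam mu * e = 4 * lam ^ 2 * e / mu := by rw [kepA]; ring
  set c := 4 * kepA lam mu * e with hcdef
  set x := w.re with hxdef
  set y := w.im with hydef
  -- Real and imaginary parts of `Z² |w|² = (w - 4ae) w̄`.
  have f1 : (X ^ 2 - Y ^ 2) * (x ^ 2 + y ^ 2) = x ^ 2 + y ^ 2 - c * x := by
    linear_combination x * e1 + y * e2
  have f2 : 2 * X * Y * (x ^ 2 + y ^ 2) = c * y := by
    linear_combination x * e2 - y * e1
  have hA : kepAlpha lam mu e (p 0) (p 1) = X := by
    rw [kepAlpha, hden, ← wre, ← hs, ← mul_pow, ← neg_sq (√(1 - e ^ 2) * p 1), ← wim, ← hc]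
    -- The two quotients inside `α` are `Re Z²` and `|Z²|²`, so the radicand is `(|Z²| + Re Z²)/2 =
    -- (Re Z)²`.
    have g2 : ((x - 2 * lam ^ 2 * e / mu) ^ 2 + y ^ 2 - 4 * lam ^ 4 * e ^ 2 / mu ^ 2)
        / (x ^ 2 + y ^ 2) = X ^ 2 - Y ^ 2 := by
      rw [div_eq_iff hD.ne', f1, hc]; field_simp; ring
    have g1 : ((x - c) ^ 2 + y ^ 2) / (x ^ 2 + y ^ 2) = (X ^ 2 + Y ^ 2) ^ 2 := by
      rw [div_eq_iff hD.ne']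
      apply mul_right_cancel₀ hD.ne'
      linear_combination (-((X ^ 2 - Y ^ 2) * (x ^ 2 + y ^ 2) + (x ^ 2 + y ^ 2 - c * x))) * f1
        - (2 * X * Y * (x ^ 2 + y ^ 2) + c * y) * f2
    rw [g2, g1, Real.sqrt_sq (by positivity)]
    rw [← Real.sqrt_sq hre.le]
    congr 1
    rw [Real.sqrt_sq hre.le]
    ring
  have hB : kepBeta lam mu e (p 0) (p 1) = Y := by
    rw [kepBeta, hA, hden, div_eq_iff (by positivity)]
    have : -2 * lam ^ 2 * e * √(1 - e ^ 2) * p 1 = mu * (c / 2) * y := by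
      rw [hc, wim]; field_simp; ring
    rw [this]
    linear_combination -mu / 2 * f2
  simp [kepZ, hA, hB]

lemma kepZ_spec (hmu : 0 < mu) (he0 : 0 < e) (he1 : e < 1) {p : Plane}
    (ha : 0 < kepA lam mu) (hp : p ∈ kepDomain lam mu e) :
    focalCoord e p ≠ 0 ∧ 0 < (kepZ lam mu e p).re ∧
      kepZ lam mu e p ^ 2 * focalCoord e p = focalCoord e p - 4 * kepA lam mu * e := by
  rw [mem_kepDomain_iff he0 he1] at hp
  have hc : 0 < 4 * kepA lam mu * e := by positivity
  have hw : focalCoord e p ≠ 0 := by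
    intro h
    apply hp
    rw [h]
    exact ⟨rfl, le_rfl, hc.le⟩
  set w := focalCoord e p
  set u : ℂ := 1 - 4 * kepA lam mu * e / w with hu
  have huw : u * w = w - 4 * kepA lam mu * e := by rw [hu]; field_simp
  -- If `1 - 4ae/w` were real and nonpositive, `w` would lie in `(0, 4ae]`, which is excluded. The
  -- principal root halves an argument in `(-π, π)`, hence has positive real part.
  have hslit : u ∈ Complex.slitPlane := by
    rw [Complex.mem_slitPlane_iff]
    by_contra! h
    obtain ⟨h1, h2⟩ := h
    have e1 := congrArg Complex.re huw
    have e2 := congrArg Complex.im huw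
    simp [h2] at e1 e2
    have e3 : w.im = 0 := by
      have : (u.re - 1) * w.im = 0 := by linear_combination e2
      rcases mul_eq_zero.1 this with h | h
      · linarith
      · exact h
    · apply hp
      refine ⟨e3, ?_, ?_⟩ <;> by_contra! <;> nlinarith
  have hu0 : u ≠ 0 := Complex.slitPlane_ne_zero hslit
  have hsq : (u ^ (1 / 2 : ℂ)) ^ 2 = u := by
    rw [← Complex.cpow_nat_mul]; norm_num
  have hre : 0 < (u ^ (1 / 2 : ℂ)).re := by
    rw [Complex.cpow_def_of_ne_zero hu0, Complex.exp_re]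
    apply mul_pos (Real.exp_pos _)
    have : (Complex.log u * (1 / 2)).im = u.arg / 2 := by
      rw [show (1 / 2 : ℂ) = ((1 / 2 : ℝ) : ℂ) by norm_num, Complex.im_mul_ofReal, Complex.log_im]
      ring
    rw [this]
    have h3 := Complex.mem_slitPlane_iff_arg.1 hslit
    have h4 := lt_of_le_of_ne (Complex.arg_le_pi u) h3.1
    have h5 := Complex.neg_pi_lt_arg u
    exact Real.cos_pos_of_mem_Ioo ⟨by linarith, by linarith⟩
  have hZ : (u ^ (1 / 2 : ℂ)) ^ 2 * w = w - 4 * kepA lam mu * e := by rw [hsq, huw]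
  have := kepZ_eq hmu he0 he1 hw hZ hre
  rw [this]
  exact ⟨hw, hre, hZ⟩

/-! ### The anomaly coordinate. -/

lemma kepA_pos (hlam : 0 < lam) (hmu : 0 < mu) : 0 < kepA lam mu := div_pos (pow_pos hlam 2) hmu

lemma sub_ne_zero_of_lt_norm {ζ : ℂ} (he0 : 0 < e) (h : e < ‖ζ‖) : ζ - e ≠ 0 := by
  intro h0
  rw [sub_eq_zero.1 h0, Complex.norm_real, Real.norm_of_nonneg he0.le] at h
  exact lt_irrefl _ h

lemma add_ne_zero_of_lt_norm {ζ : ℂ} (he0 : 0 < e) (h : e < ‖ζ‖) : ζ + e ≠ 0 := by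
  intro h0
  rw [eq_neg_of_add_eq_zero_left h0, norm_neg, Complex.norm_real,
    Real.norm_of_nonneg he0.le] at h
  exact lt_irrefl _ h

lemma ne_zero_of_lt_norm {ζ : ℂ} (he0 : 0 < e) (h : e < ‖ζ‖) : ζ ≠ 0 :=
  norm_pos_iff.1 (he0.trans h)

lemma joukowski_ne_zero {a : ℝ} {ζ : ℂ} (ha : 0 < a) (he0 : 0 < e) (h : e < ‖ζ‖) :
    joukowski a e ζ ≠ 0 :=
  div_ne_zero (mul_ne_zero (by simpa using ha.ne')
    (pow_ne_zero 2 (sub_ne_zero_of_lt_norm he0 h))) (ne_zero_of_lt_norm he0 h)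

lemma focalCoord_ofAnomaly (he0 : 0 < e) (he1 : e < 1) (a : ℝ) (ζ : ℂ) :
    focalCoord e (ofAnomaly a e ζ) = joukowski a e ζ := focalCoord_ofFocal he0 he1 _

/-- The real part is `(|ζ|² - e²)/|ζ - e|²`. -/
lemma moebius_re_pos {ζ : ℂ} (he0 : 0 < e) (h : e < ‖ζ‖) :
    0 < ((ζ + e) / (ζ - e)).re := by
  have h1 := sub_ne_zero_of_lt_norm he0 h
  have h2 : e ^ 2 < ζ.re ^ 2 + ζ.im ^ 2 := by
    rw [← norm_sq_eq_re_im]; exact pow_lt_pow_left₀ h he0.le two_ne_zero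
  have h3 := Complex.normSq_pos.2 h1
  rw [Complex.div_re, ← add_div]
  refine div_pos ?_ h3
  simp
  nlinarith

lemma moebius_sq_mul {a : ℝ} {ζ : ℂ} (he0 : 0 < e) (h : e < ‖ζ‖) :
    ((ζ + e) / (ζ - e)) ^ 2 * joukowski a e ζ = joukowski a e ζ - 4 * a * e := by
  have h1 := sub_ne_zero_of_lt_norm he0 h
  have h2 := ne_zero_of_lt_norm he0 h
  rw [joukowski]
  field_simp
  ring

lemma kepZ_ofAnomaly (hlam : 0 < lam) (hmu : 0 < mu) (he0 : 0 < e) (he1 : e < 1) {ζ : ℂ}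
    (h : e < ‖ζ‖) :
    kepZ lam mu e (ofAnomaly (kepA lam mu) e ζ) = (ζ + e) / (ζ - e) := by
  apply kepZ_eq hmu he0 he1
  · rw [focalCoord_ofAnomaly he0 he1]
    exact joukowski_ne_zero (kepA_pos hlam hmu) he0 h
  · rw [focalCoord_ofAnomaly he0 he1]
    exact moebius_sq_mul he0 h
  · exact moebius_re_pos he0 h

/-- On the segment `w` would be real in `(0, 4ae]`, so `Z² = 1 - 4ae/w ≤ 0`, which is incompatible
with `Re Z > 0`. -/
lemma ofAnomaly_mem (hlam : 0 < lam) (hmu : 0 < mu) (he0 : 0 < e) (he1 : e < 1) {ζ : ℂ}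
    (h : e < ‖ζ‖) : ofAnomaly (kepA lam mu) e ζ ∈ kepDomain lam mu e := by
  rw [mem_kepDomain_iff he0 he1, focalCoord_ofAnomaly he0 he1]
  rintro ⟨h1, h2, h3⟩
  have hZ := moebius_sq_mul (a := kepA lam mu) he0 h
  have hre := moebius_re_pos he0 h
  have hw := joukowski_ne_zero (kepA_pos hlam hmu) he0 h
  set w := joukowski (kepA lam mu) e ζ
  set Z := (ζ + e) / (ζ - e)
  have hw' : w.re ≠ 0 := fun h0 => hw (Complex.ext h0 h1)
  have hpos : 0 < w.re := lt_of_le_of_ne h2 hw'.symm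
  have e1 := congrArg Complex.re hZ
  have e2 := congrArg Complex.im hZ
  simp [pow_two, h1, hw'] at e1 e2
  have hY : Z.im = 0 := by
    have : 2 * Z.re * Z.im = 0 := by linear_combination e2
    simpa [hre.ne'] using this
  rw [hY] at e1
  nlinarith [mul_pos hre hre, mul_pos (mul_pos hre hre) hpos]

lemma anomaly_ofAnomaly (hlam : 0 < lam) (hmu : 0 < mu) (he0 : 0 < e) (he1 : e < 1) {ζ : ℂ}
    (h : e < ‖ζ‖) : anomaly lam mu e (ofAnomaly (kepA lam mu) e ζ) = ζ := by
  have h1 := sub_ne_zero_of_lt_norm he0 h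
  have he : (e : ℂ) ≠ 0 := by exact_mod_cast he0.ne'
  rw [anomaly, kepZ_ofAnomaly hlam hmu he0 he1 h]
  have : (ζ + e) / (ζ - e) - 1 ≠ 0 := by
    rw [div_sub_one h1]; refine div_ne_zero ?_ h1; ring_nf; simpa using he
  rw [div_eq_iff this]
  field_simp
  ring

lemma kepZ_ne_one (hlam : 0 < lam) (hmu : 0 < mu) (he0 : 0 < e) (he1 : e < 1) {p : Plane}
    (hp : p ∈ kepDomain lam mu e) : kepZ lam mu e p - 1 ≠ 0 := by
  have ha := kepA_pos hlam hmu
  obtain ⟨-, -, hZ⟩ := kepZ_spec hmu he0 he1 ha hp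
  intro h
  rw [sub_eq_zero.1 h, one_pow, one_mul, eq_comm, sub_eq_self] at hZ
  exact (by positivity : 4 * kepA lam mu * e ≠ 0) (by exact_mod_cast hZ)

lemma ofAnomaly_anomaly (hlam : 0 < lam) (hmu : 0 < mu) (he0 : 0 < e) (he1 : e < 1) {p : Plane}
    (hp : p ∈ kepDomain lam mu e) :
    ofAnomaly (kepA lam mu) e (anomaly lam mu e p) = p := by
  have ha := kepA_pos hlam hmu
  obtain ⟨hw, hre, hZ⟩ := kepZ_spec hmu he0 he1 ha hp
  have hZ1 := kepZ_ne_one hlam hmu he0 he1 hp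
  suffices joukowski (kepA lam mu) e (anomaly lam mu e p) = focalCoord e p by
    rw [ofAnomaly, this, ofFocal_focalCoord he0 he1]
  rw [joukowski, anomaly]
  set Z := kepZ lam mu e p
  have he : (e : ℂ) ≠ 0 := by exact_mod_cast he0.ne'
  have hZ2 : Z + 1 ≠ 0 := by
    intro h
    have := congrArg Complex.re h
    simp at this
    linarith
  field_simp
  linear_combination -hZ

/-! ### The vector field in the new coordinates. -/

/-- The Keplerian dynamical system in the anomaly coordinate. -/
def anomalyField (lam mu e : ℝ) (ζ : ℂ) : ℂ :=
  ((mu / lam / focalRadius e (joukowski (kepA lam mu) e ζ) : ℝ) : ℂ) * ζ *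
    (Complex.I + (1 + Complex.I) * ((‖ζ‖⁻¹ - 1 : ℝ) : ℂ) * (ζ / (ζ + e)))

/-- The Keplerian dynamical system in the focal coordinate, where `Z = α + i β`. -/
def focalField (k e : ℝ) (Z w : ℂ) : ℂ :=
  -((k / focalRadius e w : ℝ) : ℂ) * ((1 - Complex.I) * w * Z
    + (1 + Complex.I) * ((starRingEnd ℂ Z - 1) * (‖w‖ : ℂ) / e + w))

/-- Since `x`, `y` and `r` are linear in `|w|`, `Re w` and `Im w`, only the derivative of `|w|` has
to be computed; the rest is matching with the drift. -/
lemma hasDerivWithinAt_ofFocal (he0 : 0 < e) (he1 : e < 1) {w : ℝ → ℂ} {w' : ℂ} {I : Set ℝ}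
    {t : ℝ} (hp : focalCoord e (ofFocal e (w t)) ≠ 0)
    (hw' : w' = focalField (mu / (2 * lam)) e (kepZ lam mu e (ofFocal e (w t))) (w t))
    (hw : HasDerivWithinAt w w' I t) :
    HasDerivWithinAt (fun τ => ofFocal e (w τ)) (kepDrift lam mu e (ofFocal e (w t))) I t := by
  rw [focalCoord_ofFocal he0 he1] at hp
  have h1 := one_sub_sq_pos he0 he1
  have hs := Real.sqrt_pos.2 h1
  have hs2 : √(1 - e ^ 2) ^ 2 = 1 - e ^ 2 := Real.sq_sqrt h1.le
  have hr := focalRadius_pos he0 he1 hp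
  have hM := norm_pos_iff.2 hp
  have hMM := norm_sq_eq_re_im (w t)
  have dre : HasDerivWithinAt (fun τ => (w τ).re) w'.re I t :=
    Complex.reCLM.hasFDerivAt.comp_hasDerivWithinAt t hw
  have dim : HasDerivWithinAt (fun τ => (w τ).im) w'.im I t :=
    Complex.imCLM.hasFDerivAt.comp_hasDerivWithinAt t hw
  have dM : HasDerivWithinAt (fun τ => ‖w τ‖)
      (((w t).re * w'.re + (w t).im * w'.im) / ‖w t‖) I t := by
    have := ((dre.pow 2).add (dim.pow 2)).sqrt (by
      simp only [Pi.add_apply, Pi.pow_apply]; rw [← hMM]; positivity)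
    simp only [Pi.add_apply, Pi.pow_apply, ← norm_sq_eq_re_im, Real.sqrt_sq (norm_nonneg _)] at this
    refine this.congr_deriv ?_
    field_simp
    ring
  have dr : HasDerivWithinAt (fun τ => focalRadius e (w τ)) _ I t :=
    (dM.sub (dre.const_mul e)).div_const (1 - e ^ 2)
  have dx := (dr.const_mul e).sub dre
  have dy := dim.neg.div_const √(1 - e ^ 2)
  rw [hasDerivWithinAt_iff_hasFDerivWithinAt, hasFDerivWithinAt_euclidean]
  have hR := sqrt_ofFocal he0 he1 (w t)
  have hx : ofFocal e (w t) 0 = e * focalRadius e (w t) - (w t).re := rfl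
  have hy : ofFocal e (w t) 1 = -(w t).im / √(1 - e ^ 2) := rfl
  set r := focalRadius e (w t) with hrdef
  have hrM : ‖w t‖ = (1 - e ^ 2) * r + e * (w t).re := by
    rw [hrdef, focalRadius]; field_simp; ring
  have hre := congrArg Complex.re hw'
  have him := congrArg Complex.im hw'
  simp only [kepZ, focalField] at hre him
  set k := mu / (2 * lam) with hk
  set X := kepAlpha lam mu e (ofFocal e (w t) 0) (ofFocal e (w t) 1) with hX
  set Y := kepBeta lam mu e (ofFocal e (w t) 0) (ofFocal e (w t) 1) with hY
  set M := ‖w t‖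
  set u := (w t).re with hu
  set v := (w t).im with hv
  have hre' : w'.re = -(k / r) * ((X + Y + 1) * u + (X - Y - 1) * v + M / e * (X + Y - 1)) := by
    simp [← hrdef, Complex.div_re, Complex.div_im, Complex.normSq_apply] at hre
    rw [hre]
    field_simp
    ring
  have him' : w'.im = -(k / r) * ((X + Y + 1) * v + (X - Y - 1) * (M / e - u)) := by
    simp [← hrdef, Complex.div_re, Complex.div_im, Complex.normSq_apply] at him
    rw [him]
    field_simp
    ring
  have hM' : (u * w'.re + v * w'.im) / M
      = -(k / r) * (M * (X + Y + 1) + ((X + Y - 1) * u + (X - Y - 1) * v) / e) := by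
    rw [div_eq_iff hM.ne', hre', him']
    linear_combination (k / r * (X + Y + 1)) * hMM
  intro i
  fin_cases i
  · refine dx.congr_deriv ?_
    rw [hM', hre', hrM]
    change _ = kepDriftX lam mu e (ofFocal e (w t) 0) (ofFocal e (w t) 1)
    rw [kepDriftX, hR, ← hX, ← hY, ← hk, hx]
    field_simp
    ring
  · refine dy.congr_deriv ?_
    rw [him', hrM]
    change _ = kepDriftY lam mu e (ofFocal e (w t) 0) (ofFocal e (w t) 1)
    rw [kepDriftY, hR, ← hX, ← hY, ← hk, hy]
    field_simp
    rw [hs2]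
    ring

lemma hasDerivWithinAt_joukowski {a : ℝ} {ζ : ℝ → ℂ} {ζ' : ℂ} {I : Set ℝ} {t : ℝ}
    (h0 : ζ t ≠ 0) (hζ : HasDerivWithinAt ζ ζ' I t) :
    HasDerivWithinAt (fun τ => joukowski a e (ζ τ))
      (-a * (ζ t - e) * (ζ t + e) / ζ t ^ 2 * ζ') I t := by
  have := (((hζ.sub_const (e : ℂ)).pow 2).const_mul (-a : ℂ)).div hζ h0
  refine this.congr_deriv ?_
  simp only [Pi.pow_apply]
  field_simp
  ring

/-- The left factor is the derivative of the Joukowski map. Since `|w| = a|ζ-e|²/|ζ|`, the claim is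
a rational identity in `ζ`, its conjugate and `|ζ|`, in which `r` enters only as a common factor
`1/r`. -/
lemma focalField_joukowski (hlam : 0 < lam) (hmu : 0 < mu) (he0 : 0 < e)
    {ζ : ℂ} (h : e < ‖ζ‖) :
    -(kepA lam mu : ℂ) * (ζ - e) * (ζ + e) / ζ ^ 2 * anomalyField lam mu e ζ =
      focalField (mu / (2 * lam)) e ((ζ + e) / (ζ - e)) (joukowski (kepA lam mu) e ζ) := by
  have h1 := sub_ne_zero_of_lt_norm he0 h
  have h2 := add_ne_zero_of_lt_norm he0 h
  have h3 := ne_zero_of_lt_norm he0 h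
  have he : (e : ℂ) ≠ 0 := by exact_mod_cast he0.ne'
  have ha := kepA_pos hlam hmu
  have h4 : starRingEnd ℂ ζ - e ≠ 0 := by
    intro h
    apply h1
    have := congrArg (starRingEnd ℂ) h
    simpa using this
  have hn : (‖joukowski (kepA lam mu) e ζ‖ : ℂ)
      = kepA lam mu * ((ζ - e) * (starRingEnd ℂ ζ - e)) / ‖ζ‖ := by
    rw [joukowski, norm_div, norm_mul, norm_neg, norm_pow, Complex.norm_real,
      Real.norm_of_nonneg ha.le]
    push_cast
    rw [← Complex.mul_conj']
    simp
  have h5 : (‖ζ‖ : ℂ) ≠ 0 := by exact_mod_cast (norm_pos_iff.2 h3).ne'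
  rw [focalField, anomalyField, hn]
  simp only [joukowski, map_div₀, map_add, map_sub, Complex.conj_ofReal]
  generalize focalRadius e (-kepA lam mu * (ζ - e) ^ 2 / ζ) = r
  have hl : (lam : ℂ) ≠ 0 := by exact_mod_cast hlam.ne'
  -- With `r` generalised, `r = 0` is allowed; division by zero then makes both sides vanish.
  by_cases hr : (r : ℂ) = 0
  · simp [hr]
  push_cast
  field_simp
  ring

lemma hasDerivWithinAt_ofAnomaly (hlam : 0 < lam) (hmu : 0 < mu) (he0 : 0 < e) (he1 : e < 1)
    {ζ : ℝ → ℂ} {I : Set ℝ} {t : ℝ} (h : e < ‖ζ t‖)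
    (hζ : HasDerivWithinAt ζ (anomalyField lam mu e (ζ t)) I t) :
    HasDerivWithinAt (fun τ => ofAnomaly (kepA lam mu) e (ζ τ))
      (kepDrift lam mu e (ofAnomaly (kepA lam mu) e (ζ t))) I t := by
  refine hasDerivWithinAt_ofFocal (w := fun τ => joukowski (kepA lam mu) e (ζ τ)) he0 he1 ?_ ?_
    (hasDerivWithinAt_joukowski (ne_zero_of_lt_norm he0 h) hζ)
  · rw [focalCoord_ofFocal he0 he1]
    exact joukowski_ne_zero (kepA_pos hlam hmu) he0 h
  · rw [focalField_joukowski hlam hmu he0 h, ← kepZ_ofAnomaly hlam hmu he0 he1 h]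
    rfl

/-! ### Global existence and uniqueness for ordinary differential equations. -/

open scoped NNReal Manifold in
/-- A `C¹` map on an open set agrees on a compact subset with a bounded Lipschitz map. -/
lemma exists_lipschitz_bounded_eqOn {E : Type*} [NormedAddCommGroup E] [NormedSpace ℝ E]
    [FiniteDimensional ℝ E] {f : E → E} {O K : Set E} (hO : IsOpen O) (hK : IsCompact K)
    (hKO : K ⊆ O) (hf : ContDiffOn ℝ 1 f O) :
    ∃ (g : E → E) (C B : ℝ≥0), LipschitzWith C g ∧ (∀ x, ‖g x‖ ≤ B) ∧ EqOn g f K := by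
  obtain ⟨K', hK', hKK', hK'O⟩ := exists_compact_between hK hO hKO
  obtain ⟨χ, h0, h1, -⟩ := exists_contMDiffMap_zero_one_nhds_of_isClosed (n := 1) 𝓘(ℝ, E)
    (s := (interior K')ᶜ) (t := K) isOpen_interior.isClosed_compl hK.isClosed
    (disjoint_compl_left_iff_subset.2 hKK')
  have hχ : ContDiff ℝ 1 χ := χ.contMDiff.contDiff
  -- Vanishing on a whole neighbourhood, not just at the point, is what makes `χ • f` smooth outside
  -- `O`, where nothing is known about `f`.
  have hzero : ∀ x ∉ K', ∀ᶠ y in 𝓝 x, χ y = 0 := fun x hx =>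
    h0.filter_mono (nhds_le_nhdsSet (show x ∈ (interior K')ᶜ from fun h => hx (interior_subset h)))
  have hg : ContDiff ℝ 1 fun x => χ x • f x := by
    rw [contDiff_iff_contDiffAt]
    intro x
    by_cases hx : x ∈ K'
    · exact hχ.contDiffAt.smul (hf.contDiffAt (hO.mem_nhds (hK'O hx)))
    · refine (contDiffAt_const (c := (0 : E))).congr_of_eventuallyEq ?_
      filter_upwards [hzero x hx] with y hy
      simp [hy]
  have hsupp : HasCompactSupport fun x => χ x • f x := by
    refine HasCompactSupport.intro hK' fun x hx => ?_
    simp [(hzero x hx).self_of_nhds]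
  obtain ⟨C, hC⟩ := hg.lipschitzWith_of_hasCompactSupport hsupp one_ne_zero
  obtain ⟨B, hB⟩ := hsupp.exists_bound_of_continuous hg.continuous
  refine ⟨_, C, B.toNNReal, hC, fun x => (hB x).trans (Real.le_coe_toNNReal B), fun x hx => ?_⟩
  have : χ x = 1 := (h1.filter_mono (nhds_le_nhdsSet hx)).self_of_nhds
  simp [this]

open scoped NNReal in
/-- A bounded Lipschitz vector field has solutions for all future times. -/
lemma exists_forall_Ici_hasDerivWithinAt {E : Type*} [NormedAddCommGroup E] [NormedSpace ℝ E]
    [CompleteSpace E] {g : E → E} {C B : ℝ≥0} (hC : LipschitzWith C g) (hB : ∀ x, ‖g x‖ ≤ B)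
    (t₀ : ℝ) (x₀ : E) :
    ∃ x : ℝ → E, x t₀ = x₀ ∧ ∀ t ∈ Ici t₀, HasDerivWithinAt x (g (x t)) (Ici t₀) t := by
  have key : ∀ n : ℕ, ∃ x : ℝ → E, x t₀ = x₀ ∧
      ∀ t ∈ Icc t₀ (t₀ + n), HasDerivWithinAt x (g (x t)) (Icc t₀ (t₀ + n)) t := by
    intro n
    have hmem : t₀ ∈ Icc t₀ (t₀ + n) := ⟨le_rfl, by simp⟩
    -- In time `n` a curve of speed at most `B` stays in the ball of radius `B * n`, so the time
    -- interval need not shrink.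
    have : IsPicardLindelof (fun _ => g) (⟨t₀, hmem⟩ : Icc t₀ (t₀ + n)) x₀ (B * n) 0 B C :=
      { lipschitzOnWith := fun _ _ => hC.lipschitzOnWith
        continuousOn := fun _ _ => continuousOn_const
        norm_le := fun _ _ x _ => hB x
        mul_max_le := by simp }
    exact this.exists_eq_forall_mem_Icc_hasDerivWithinAt₀
  choose x hx0 hx using key
  have hright : ∀ n : ℕ, ∀ t ∈ Ico t₀ (t₀ + n),
      HasDerivWithinAt (x n) (g (x n t)) (Ici t) t := fun n t ht =>
    (hx n t ⟨ht.1, ht.2.le⟩).mono_of_mem_nhdsWithin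
      (mem_of_superset (Icc_mem_nhdsGE ht.2) (Icc_subset_Icc_left ht.1))
  have hcont : ∀ n : ℕ, ContinuousOn (x n) (Icc t₀ (t₀ + n)) := fun n t ht =>
    (hx n t ht).continuousWithinAt
  have agree : ∀ m n : ℕ, m ≤ n → EqOn (x m) (x n) (Icc t₀ (t₀ + m)) := by
    intro m n hmn
    have hle : t₀ + m ≤ t₀ + n := by gcongr
    exact ODE_solution_unique_of_mem_Icc_right (v := fun _ => g) (s := fun _ => univ)
      (fun _ _ => hC.lipschitzOnWith) (hcont m) (hright m) (fun _ _ => mem_univ _)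
      ((hcont n).mono (Icc_subset_Icc_right hle))
      (fun t ht => hright n t ⟨ht.1, ht.2.trans_le hle⟩) (fun _ _ => mem_univ _)
      ((hx0 m).trans (hx0 n).symm)
  -- The solution number `⌈t - t₀⌉₊` is the first one whose interval contains `t`.
  set y : ℝ → E := fun t => x ⌈t - t₀⌉₊ t with hy
  have hyx : ∀ n : ℕ, EqOn y (x n) (Icc t₀ (t₀ + n)) := by
    intro n t ht
    refine agree _ n (Nat.ceil_le.2 (by linarith [ht.2])) ⟨ht.1, ?_⟩
    linarith [Nat.le_ceil (t - t₀)]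
  refine ⟨y, ?_, fun t ht => ?_⟩
  · rw [hyx 0 ⟨le_rfl, by simp⟩, hx0]
  · obtain ⟨n, hn⟩ := exists_nat_gt (t - t₀)
    have htn : t < t₀ + n := by linarith
    have hmem : t ∈ Icc t₀ (t₀ + n) := ⟨ht, htn.le⟩
    rw [hyx n hmem]
    refine ((hx n t hmem).congr (hyx n) (hyx n hmem)).mono_of_mem_nhdsWithin ?_
    rw [← Ici_inter_Iic]
    exact inter_mem self_mem_nhdsWithin (mem_nhdsWithin_of_mem_nhds (Iic_mem_nhds htn))

/-- Solutions of a `C¹` planar system are unique to the right. -/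
lemma IsSolutionOn.isTrajectory {b : Plane → Plane} {U : Set Plane} (hU : IsOpen U)
    (hb : ContDiffOn ℝ 1 b U) {t₀ : ℝ} {x : ℝ → Plane} (hx : IsSolutionOn b U (Ici t₀) x) :
    IsTrajectory b U t₀ (x t₀) x := by
  refine ⟨hx, rfl, fun T y hy h0 t ht => ?_⟩
  have hloc : LocallyLipschitzOn U b := by
    intro p hp
    obtain ⟨K, s, hs, h⟩ := (hb.contDiffAt (hU.mem_nhds hp)).exists_lipschitzOnWith
    exact ⟨K, s, mem_nhdsWithin_of_mem_nhds hs, h⟩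
  have hxc : ContinuousOn x (Icc t₀ t) := fun τ hτ =>
    ((hx τ hτ.1).2.continuousWithinAt).mono Icc_subset_Ici_self
  have hsub : Icc t₀ t ⊆ Ico t₀ T := fun τ hτ => ⟨hτ.1, hτ.2.trans_lt ht.2⟩
  have hyc : ContinuousOn y (Icc t₀ t) := fun τ hτ =>
    ((hy τ (hsub hτ)).2.continuousWithinAt).mono hsub
  -- The field is only locally Lipschitz on `U`; a uniform constant exists on the compact union of
  -- the two arcs, which suffices for uniqueness.
  have hcomp : IsCompact (x '' Icc t₀ t ∪ y '' Icc t₀ t) :=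
    (isCompact_Icc.image_of_continuousOn hxc).union (isCompact_Icc.image_of_continuousOn hyc)
  have hKU : x '' Icc t₀ t ∪ y '' Icc t₀ t ⊆ U := by
    rintro _ (⟨τ, hτ, rfl⟩ | ⟨τ, hτ, rfl⟩)
    · exact (hx τ hτ.1).1
    · exact (hy τ (hsub hτ)).1
  obtain ⟨K, hK⟩ := (hloc.mono hKU).exists_lipschitzOnWith_of_compact hcomp
  refine ODE_solution_unique_of_mem_Icc_right (v := fun _ => b) (fun _ _ => hK) hyc ?_ ?_ hxc
    ?_ ?_ h0 ⟨ht.1, le_rfl⟩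
  · intro τ hτ
    exact (hy τ (hsub ⟨hτ.1, hτ.2.le⟩)).2.mono_of_mem_nhdsWithin
      (mem_of_superset (Ico_mem_nhdsGE (hτ.2.trans ht.2)) (Ico_subset_Ico_left hτ.1))
  · exact fun τ hτ => Or.inr (mem_image_of_mem _ ⟨hτ.1, hτ.2.le⟩)
  · intro τ hτ
    exact (hx τ hτ.1).2.mono (Ici_subset_Ici.2 hτ.1)
  · exact fun τ hτ => Or.inl (mem_image_of_mem _ ⟨hτ.1, hτ.2.le⟩)

/-! ### The Lyapunov function. -/

/-- The Lyapunov function of the Kepler ellipse, in the anomaly coordinate. -/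
def lyapunov (e : ℝ) (ζ : ℂ) : ℝ := (‖ζ‖ ^ 2 - 1) ^ 2 * ‖ζ + e‖ ^ 2

/-- The logarithmic derivative of the Lyapunov function along trajectories. -/
def lyapunovRate (lam mu e : ℝ) (ζ : ℂ) : ℝ :=
  2 * (mu / lam / focalRadius e (joukowski (kepA lam mu) e ζ)) *
    (-(2 * ‖ζ‖ / (1 + ‖ζ‖)) * ((1 + Complex.I) * (ζ / (ζ + e))).re
      + (Complex.I * (ζ / (ζ + e))).re
      + (‖ζ‖⁻¹ - 1) * ((1 + Complex.I) * (ζ / (ζ + e)) ^ 2).re)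

/-- The radial velocity contains the factor `1/|ζ| - 1`, which cancels against `|ζ|² - 1` in the
logarithmic derivative; the formula thus holds on the circle as well. -/
lemma hasDerivWithinAt_lyapunov (he0 : 0 < e) {ζ : ℝ → ℂ} {I : Set ℝ} {t : ℝ}
    (h : e < ‖ζ t‖) (hζ : HasDerivWithinAt ζ (anomalyField lam mu e (ζ t)) I t) :
    HasDerivWithinAt (fun τ => lyapunov e (ζ τ))
      (lyapunovRate lam mu e (ζ t) * lyapunov e (ζ t)) I t := by
  have h2 := add_ne_zero_of_lt_norm he0 h
  have h3 := ne_zero_of_lt_norm he0 h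
  have hρ := norm_pos_iff.2 h3
  have d1 := hζ.norm_sq
  have d2 := (hζ.add_const (e : ℂ)).norm_sq
  have d := ((d1.sub_const 1).pow 2).mul d2
  refine d.congr_deriv ?_
  simp only [Complex.inner, Pi.pow_apply]
  set P := ζ t / (ζ t + e) with hP
  set k := mu / lam / focalRadius e (joukowski (kepA lam mu) e (ζ t)) with hk
  have hf : anomalyField lam mu e (ζ t)
      = (k : ℂ) * ζ t * (Complex.I + (1 + Complex.I) * ((‖ζ t‖⁻¹ - 1 : ℝ) : ℂ) * P) := rfl
  have i1 : (anomalyField lam mu e (ζ t) * starRingEnd ℂ (ζ t)).re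
      = k * ‖ζ t‖ ^ 2 * ((‖ζ t‖⁻¹ - 1) * ((1 + Complex.I) * P).re) := by
    have : anomalyField lam mu e (ζ t) * starRingEnd ℂ (ζ t) = ((k * ‖ζ t‖ ^ 2 : ℝ) : ℂ) *
        (Complex.I + ((‖ζ t‖⁻¹ - 1 : ℝ) : ℂ) * ((1 + Complex.I) * P)) := by
      rw [hf]
      push_cast
      rw [← Complex.mul_conj']
      ring
    rw [this, Complex.re_ofReal_mul, Complex.add_re, Complex.re_ofReal_mul, Complex.I_re, zero_add]
  have i2 : (anomalyField lam mu e (ζ t) * starRingEnd ℂ (ζ t + e)).re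
      = k * ‖ζ t + e‖ ^ 2 * ((Complex.I * P).re
        + (‖ζ t‖⁻¹ - 1) * ((1 + Complex.I) * P ^ 2).re) := by
    have : anomalyField lam mu e (ζ t) * starRingEnd ℂ (ζ t + e)
        = ((k * ‖ζ t + e‖ ^ 2 : ℝ) : ℂ) *
        (Complex.I * P + ((‖ζ t‖⁻¹ - 1 : ℝ) : ℂ) * ((1 + Complex.I) * P ^ 2)) := by
      -- Replacing `ζ` by `P(ζ+e)` brings out the factor `|ζ+e|²`.
      have hζP : ζ t = P * (ζ t + e) := by rw [hP]; field_simp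
      rw [hf]
      push_cast
      rw [← Complex.mul_conj']
      linear_combination (k * (Complex.I + (1 + Complex.I) * ((‖ζ t‖ : ℂ)⁻¹ - 1) * P)
        * starRingEnd ℂ (ζ t + e)) * hζP
    rw [this, Complex.re_ofReal_mul, Complex.add_re, Complex.re_ofReal_mul]
  rw [i1, i2, lyapunov, lyapunovRate, ← hk, ← hP]
  field_simp
  ring

/-- On the circle the two `Re(iP)` terms cancel and `-2k Re P` is left; `Re P` has the sign of `1 +
e Re ζ > 0`. -/
lemma lyapunovRate_neg (hlam : 0 < lam) (hmu : 0 < mu) (he0 : 0 < e) (he1 : e < 1) {ζ : ℂ}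
    (h : ‖ζ‖ = 1) : lyapunovRate lam mu e ζ < 0 := by
  have hlt : e < ‖ζ‖ := by rwa [h]
  have h2 := add_ne_zero_of_lt_norm he0 hlt
  have hr := focalRadius_pos he0 he1 (joukowski_ne_zero (kepA_pos hlam hmu) he0 hlt)
  have hN := norm_sq_eq_re_im ζ
  rw [h] at hN
  have hP : 0 < (ζ / (ζ + e)).re := by
    rw [Complex.div_re, ← add_div]
    refine div_pos ?_ (Complex.normSq_pos.2 h2)
    have : |ζ.re| ≤ 1 := h ▸ Complex.abs_re_le_norm ζ
    simp
    nlinarith [neg_abs_le ζ.re]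
  rw [lyapunovRate, h]
  have : (-(2 * 1 / (1 + 1)) * ((1 + Complex.I) * (ζ / (ζ + e))).re
      + (Complex.I * (ζ / (ζ + e))).re
      + ((1 : ℝ)⁻¹ - 1) * ((1 + Complex.I) * (ζ / (ζ + e)) ^ 2).re) = -(ζ / (ζ + e)).re := by
    rw [add_mul, one_mul, Complex.add_re]
    ring
  rw [this]
  have : 0 < mu / lam / focalRadius e (joukowski (kepA lam mu) e ζ) := by positivity
  nlinarith

/-! ### Regularity, and uniform decay on an annulus. -/

lemma isOpen_lt_norm (c : ℝ) : IsOpen {ζ : ℂ | c < ‖ζ‖} := isOpen_lt continuous_const continuous_norm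

lemma contDiffAt_joukowski {ζ : ℂ} (a : ℝ) (he0 : 0 < e) (h : e < ‖ζ‖) :
    ContDiffAt ℝ 1 (joukowski a e) ζ := by
  have h3 := ne_zero_of_lt_norm he0 h
  simp only [funext_iff.2 fun ζ => show joukowski a e ζ = _ from div_eq_mul_inv _ _]
  exact (contDiffAt_const.mul ((contDiffAt_id.sub contDiffAt_const).pow 2)).mul
    (contDiffAt_id.inv h3)

lemma contDiffAt_focalRadius {w : ℂ} (h : w ≠ 0) : ContDiffAt ℝ 1 (focalRadius e) w := by
  unfold focalRadius
  exact ((contDiffAt_id.norm ℝ h).sub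
    (contDiffAt_const.mul Complex.reCLM.contDiff.contDiffAt)).div_const _

lemma contDiffAt_focalRadius_joukowski {a : ℝ} {ζ : ℂ} (ha : 0 < a) (he0 : 0 < e)
    (h : e < ‖ζ‖) : ContDiffAt ℝ 1 (fun ζ => focalRadius e (joukowski a e ζ)) ζ :=
  (contDiffAt_focalRadius (joukowski_ne_zero ha he0 h)).comp ζ (contDiffAt_joukowski a he0 h)

lemma contDiffOn_anomalyField (hlam : 0 < lam) (hmu : 0 < mu) (he0 : 0 < e) (he1 : e < 1) :
    ContDiffOn ℝ 1 (anomalyField lam mu e) {ζ : ℂ | e < ‖ζ‖} := by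
  intro ζ h
  apply ContDiffAt.contDiffWithinAt
  have h2 := add_ne_zero_of_lt_norm he0 h
  have h3 := ne_zero_of_lt_norm he0 h
  have hw := joukowski_ne_zero (kepA_pos hlam hmu) he0 h
  have hr := (focalRadius_pos he0 he1 hw).ne'
  have d1 := contDiffAt_focalRadius_joukowski (kepA_pos hlam hmu) he0 h
  have d2 := (contDiffAt_norm (n := 1) ℝ h3).inv (norm_ne_zero_iff.2 h3)
  have d3 : ContDiffAt ℝ 1 (fun ζ : ℂ => ζ / (ζ + e)) ζ := by
    simp only [div_eq_mul_inv]
    exact contDiffAt_id.mul ((contDiffAt_id.add contDiffAt_const).inv h2)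
  have d4 : ContDiffAt ℝ 1 (fun ζ => ((mu / lam / focalRadius e
      (joukowski (kepA lam mu) e ζ) : ℝ) : ℂ)) ζ :=
    Complex.ofRealCLM.contDiff.contDiffAt.comp ζ (contDiffAt_const.div d1 hr)
  have d5 : ContDiffAt ℝ 1 (fun ζ : ℂ => ((‖ζ‖⁻¹ - 1 : ℝ) : ℂ)) ζ :=
    Complex.ofRealCLM.contDiff.contDiffAt.comp ζ (d2.sub contDiffAt_const)
  exact (d4.mul contDiffAt_id).mul (contDiffAt_const.add ((contDiffAt_const.mul d5).mul d3))

lemma continuousAt_lyapunovRate (hlam : 0 < lam) (hmu : 0 < mu) (he0 : 0 < e) (he1 : e < 1)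
    {ζ : ℂ} (h : e < ‖ζ‖) : ContinuousAt (lyapunovRate lam mu e) ζ := by
  have h2 := add_ne_zero_of_lt_norm he0 h
  have h3 := norm_ne_zero_iff.2 (ne_zero_of_lt_norm he0 h)
  have h4 : 1 + ‖ζ‖ ≠ 0 := by positivity
  have hw := joukowski_ne_zero (kepA_pos hlam hmu) he0 h
  have hr := (focalRadius_pos he0 he1 hw).ne'
  have d1 := (contDiffAt_focalRadius_joukowski (kepA_pos hlam hmu) he0 h).continuousAt
  have d3 : ContinuousAt (fun ζ : ℂ => ζ / (ζ + e)) ζ := by fun_prop (disch := assumption)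
  have d4 : ContinuousAt (fun ζ : ℂ => 2 * ‖ζ‖ / (1 + ‖ζ‖)) ζ := by
    fun_prop (disch := assumption)
  have d5 : ContinuousAt (fun ζ : ℂ => ‖ζ‖⁻¹ - 1) ζ := by fun_prop (disch := assumption)
  have re {f : ℂ → ℂ} (hf : ContinuousAt f ζ) : ContinuousAt (fun ζ => (f ζ).re) ζ :=
    Complex.continuous_re.continuousAt.comp hf
  exact (continuousAt_const.mul (continuousAt_const.div d1 hr)).mul
    (((d4.neg.mul (re (continuousAt_const.mul d3))).add (re (continuousAt_const.mul d3))).add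
      (d5.mul (re (continuousAt_const.mul (d3.pow 2)))))

lemma exists_annulus_subset {G : Set ℂ} (hG : IsOpen G) (h : ∀ ζ : ℂ, ‖ζ‖ = 1 → ζ ∈ G) :
    ∃ δ : ℝ, 0 < δ ∧ δ < 1 ∧ ∀ ζ : ℂ, |‖ζ‖ ^ 2 - 1| ≤ δ → ζ ∈ G := by
  obtain ⟨δ, hδ, hsub⟩ := (isCompact_sphere (0 : ℂ) 1).exists_thickening_subset_open hG
    fun ζ hζ => h ζ (by simpa using hζ)
  -- The bound `1/2` keeps `ζ` away from `0`, so that `ζ/|ζ|` is a point of the circle; `δ/2` makes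
  -- its distance to `ζ` strictly less than `δ`.
  refine ⟨min (δ / 2) (1 / 2), by positivity, (min_le_right _ _).trans_lt (by norm_num),
    fun ζ hζ => hsub ?_⟩
  have hζ0 : ζ ≠ 0 := by
    rintro rfl
    have := hζ.trans (min_le_right _ _)
    norm_num at this
  have hρ := norm_pos_iff.2 hζ0
  rw [Metric.mem_thickening_iff]
  refine ⟨((‖ζ‖⁻¹ : ℝ) : ℂ) * ζ, by simp [hζ0], ?_⟩
  have h1 : dist ζ (((‖ζ‖⁻¹ : ℝ) : ℂ) * ζ) = |‖ζ‖ - 1| := by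
    rw [dist_eq_norm, show ζ - ((‖ζ‖⁻¹ : ℝ) : ℂ) * ζ = ((1 - ‖ζ‖⁻¹ : ℝ) : ℂ) * ζ by push_cast; ring,
      norm_mul, Complex.norm_real, Real.norm_eq_abs]
    nth_rw 2 [← abs_of_pos hρ]
    rw [← abs_mul, sub_mul, inv_mul_cancel₀ hρ.ne', one_mul]
  have h2 : |‖ζ‖ ^ 2 - 1| = |‖ζ‖ - 1| * (‖ζ‖ + 1) := by
    rw [show ‖ζ‖ ^ 2 - 1 = (‖ζ‖ - 1) * (‖ζ‖ + 1) by ring, abs_mul,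
      abs_of_pos (by positivity : 0 < ‖ζ‖ + 1)]
  have h3 := hζ.trans (min_le_left _ _)
  rw [h1]
  nlinarith [abs_nonneg (‖ζ‖ - 1)]

/-- The rate attains a negative maximum on the compact circle, and half of it bounds the rate
nearby. The radius `(1+e)/2`, midway between `e` and `1`, keeps `|ζ+e|` bounded below. -/
lemma exists_lyapunovRate_le (hlam : 0 < lam) (hmu : 0 < mu) (he0 : 0 < e) (he1 : e < 1) :
    ∃ δ κ : ℝ, 0 < δ ∧ δ < 1 ∧ 0 < κ ∧ ∀ ζ : ℂ, |‖ζ‖ ^ 2 - 1| ≤ δ →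
      (1 + e) / 2 < ‖ζ‖ ∧ lyapunovRate lam mu e ζ ≤ -κ := by
  have hc : ContinuousOn (lyapunovRate lam mu e) {ζ : ℂ | (1 + e) / 2 < ‖ζ‖} := fun ζ hζ =>
    (continuousAt_lyapunovRate hlam hmu he0 he1
      (show e < ‖ζ‖ from by have : (1 + e) / 2 < ‖ζ‖ := hζ; linarith)).continuousWithinAt
  have hs : Metric.sphere (0 : ℂ) 1 ⊆ {ζ : ℂ | (1 + e) / 2 < ‖ζ‖} := by
    intro ζ hζ
    rw [mem_sphere_zero_iff_norm] at hζ
    change (1 + e) / 2 < ‖ζ‖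
    linarith
  obtain ⟨ζ₀, hζ₀, hmax⟩ := (isCompact_sphere (0 : ℂ) 1).exists_isMaxOn
    (NormedSpace.sphere_nonempty.2 zero_le_one) (hc.mono hs)
  have hneg := lyapunovRate_neg hlam hmu he0 he1 (mem_sphere_zero_iff_norm.1 hζ₀)
  obtain ⟨δ, hδ, hδ1, hsub⟩ := exists_annulus_subset
    (hc.isOpen_inter_preimage (isOpen_lt_norm _) (isOpen_Iio (a := lyapunovRate lam mu e ζ₀ / 2)))
    fun ζ hζ => ⟨hs (mem_sphere_zero_iff_norm.2 hζ),
      show lyapunovRate lam mu e ζ < _ from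
        (isMaxOn_iff.1 hmax ζ (mem_sphere_zero_iff_norm.2 hζ)).trans_lt (by linarith)⟩
  refine ⟨δ, -(lyapunovRate lam mu e ζ₀ / 2), hδ, hδ1, by linarith, fun ζ hζ => ?_⟩
  obtain ⟨h1, h2⟩ := hsub ζ hζ
  refine ⟨h1, ?_⟩
  have : lyapunovRate lam mu e ζ < _ := h2
  linarith

lemma norm_add_bounds {ζ : ℂ} (he0 : 0 < e) (he1 : e < 1) (h : (1 + e) / 2 < ‖ζ‖)
    (h2 : |‖ζ‖ ^ 2 - 1| ≤ 1) : (1 - e) / 2 ≤ ‖ζ + e‖ ∧ ‖ζ + e‖ ≤ 3 := by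
  have hen : ‖(e : ℂ)‖ = e := by rw [Complex.norm_real, Real.norm_of_nonneg he0.le]
  constructor
  · have := norm_sub_norm_le ζ (-(e : ℂ))
    rw [sub_neg_eq_add, norm_neg, hen] at this
    linarith
  · have := norm_add_le ζ (e : ℂ)
    have h3 := (abs_le.1 h2).2
    nlinarith

lemma sq_mul_le_lyapunov {ζ : ℂ} (he0 : 0 < e) (he1 : e < 1) (h : (1 + e) / 2 < ‖ζ‖)
    (h2 : |‖ζ‖ ^ 2 - 1| ≤ 1) : (‖ζ‖ ^ 2 - 1) ^ 2 * ((1 - e) / 2) ^ 2 ≤ lyapunov e ζ :=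
  mul_le_mul_of_nonneg_left
    (pow_le_pow_left₀ (by linarith) (norm_add_bounds he0 he1 h h2).1 2) (sq_nonneg _)

lemma lyapunov_le_sq_mul {ζ : ℂ} (he0 : 0 < e) (he1 : e < 1) (h : (1 + e) / 2 < ‖ζ‖)
    (h2 : |‖ζ‖ ^ 2 - 1| ≤ 1) : lyapunov e ζ ≤ (‖ζ‖ ^ 2 - 1) ^ 2 * 3 ^ 2 :=
  mul_le_mul_of_nonneg_left
    (pow_le_pow_left₀ (norm_nonneg _) (norm_add_bounds he0 he1 h h2).2 2) (sq_nonneg _)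

lemma lyapunov_nonneg (e : ℝ) (ζ : ℂ) : 0 ≤ lyapunov e ζ := by unfold lyapunov; positivity

/-! ### Trapping and convergence in the anomaly coordinate. -/

/-- A continuous function cannot leave a sublevel set without attaining the level. -/
lemma exists_first_exit {φ : ℝ → ℝ} {t₀ t δ : ℝ} (hφ : ContinuousOn φ (Ici t₀))
    (h0 : φ t₀ < δ) (ht : t₀ ≤ t) (h : δ ≤ φ t) :
    ∃ T, t₀ < T ∧ φ T = δ ∧ ∀ s ∈ Ico t₀ T, φ s < δ := by
  have hclosed : IsClosed (Icc t₀ t ∩ φ ⁻¹' Ici δ) :=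
    (hφ.mono Icc_subset_Ici_self).preimage_isClosed_of_isClosed isClosed_Icc isClosed_Ici
  obtain ⟨T, ⟨hT, hTδ⟩, hmin⟩ := (isCompact_Icc.of_isClosed_subset hclosed
    inter_subset_left).exists_isLeast ⟨t, ⟨ht, le_rfl⟩, h⟩
  have hlt : ∀ s ∈ Ico t₀ T, φ s < δ := by
    intro s hs
    by_contra! hcon
    exact absurd (hmin ⟨⟨hs.1, hs.2.le.trans hT.2⟩, hcon⟩) (not_le.2 hs.2)
  have hT0 : t₀ < T := by
    refine lt_of_le_of_ne hT.1 ?_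
    rintro rfl
    exact absurd h0 (not_lt.2 hTδ)
  refine ⟨T, hT0, le_antisymm ?_ hTδ, hlt⟩
  have hlim : Tendsto φ (𝓝[Ico t₀ T] T) (𝓝 (φ T)) :=
    (hφ T hT.1).mono_left (nhdsWithin_mono _ Ico_subset_Ici_self)
  have : (𝓝[Ico t₀ T] T).NeBot := by
    rw [← mem_closure_iff_nhdsWithin_neBot, closure_Ico hT0.ne]
    exact ⟨hT0.le, le_rfl⟩
  exact le_of_tendsto hlim (eventually_nhdsWithin_of_forall fun s hs => (hlt s hs).le)

lemma antitoneOn_of_hasDerivWithinAt_Ici {φ φ' : ℝ → ℝ} {t₀ : ℝ} {D : Set ℝ}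
    (hD : Convex ℝ D) (hsub : D ⊆ Ici t₀)
    (hc : ContinuousOn φ D) (h : ∀ t ∈ interior D, HasDerivWithinAt φ (φ' t) (Ici t₀) t)
    (hneg : ∀ t ∈ interior D, φ' t ≤ 0) : AntitoneOn φ D := by
  have hd : ∀ t ∈ interior D, HasDerivAt φ (φ' t) t := fun t ht =>
    (h t ht).hasDerivAt (mem_of_superset (mem_interior_iff_mem_nhds.1 ht) hsub)
  exact antitoneOn_of_deriv_nonpos hD hc
    (fun t ht => (hd t ht).differentiableAt.differentiableWithinAt)
    fun t ht => (hd t ht).deriv ▸ hneg t ht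

/-- The field is cut off outside a compact annulus, which gives a solution for all `t ≥ t₀`;
monotonicity of `V` keeps it in the annulus, where the cut-off field is the true one. -/
lemma exists_anomaly_solution (hlam : 0 < lam) (hmu : 0 < mu) (he0 : 0 < e) (he1 : e < 1) :
    ∃ δ₀ : ℝ, 0 < δ₀ ∧ ∀ δ : ℝ, 0 < δ → δ ≤ δ₀ → ∃ η : ℝ, 0 < η ∧
      ∀ (t₀ : ℝ) (ζ₀ : ℂ), |‖ζ₀‖ ^ 2 - 1| < η → ∃ ζ : ℝ → ℂ, ζ t₀ = ζ₀ ∧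
        (∀ t ∈ Ici t₀, HasDerivWithinAt ζ (anomalyField lam mu e (ζ t)) (Ici t₀) t ∧
          e < ‖ζ t‖ ∧ |‖ζ t‖ ^ 2 - 1| ≤ δ) ∧
        Tendsto (fun t => ‖ζ t‖ ^ 2) atTop (𝓝 1) := by
  obtain ⟨δ₀, κ, hδ₀, hδ₁, hκ, hrate⟩ := exists_lyapunovRate_le hlam hmu he0 he1
  refine ⟨δ₀, hδ₀, fun δ hδ hle => ?_⟩
  have hm : 0 < (1 - e) / 2 := by linarith
  set m := (1 - e) / 2 with hmdef
  -- Chosen from `m²(|ζ|²-1)² ≤ V ≤ 3²(|ζ|²-1)²`.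
  refine ⟨δ * m / 3, by positivity, fun t₀ ζ₀ hζ₀ => ?_⟩
  have hAc : IsCompact {ζ : ℂ | |‖ζ‖ ^ 2 - 1| ≤ δ} := by
    refine Metric.isCompact_of_isClosed_isBounded
      (isClosed_le (by fun_prop) continuous_const) ?_
    refine (Metric.isBounded_closedBall (x := (0 : ℂ)) (r := 2)).subset fun ζ hζ => ?_
    have := (abs_le.1 (show |‖ζ‖ ^ 2 - 1| ≤ δ from hζ)).2
    rw [mem_closedBall_zero_iff]
    nlinarith [norm_nonneg ζ]
  have hgt : ∀ ζ : ℂ, |‖ζ‖ ^ 2 - 1| ≤ δ → e < ‖ζ‖ := fun ζ hζ => by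
    have := (hrate ζ (hζ.trans hle)).1
    linarith
  obtain ⟨g, C, B, hC, hB, hg⟩ := exists_lipschitz_bounded_eqOn (isOpen_lt_norm e) hAc hgt
    (contDiffOn_anomalyField hlam hmu he0 he1)
  obtain ⟨ζ, hζ0, hζ⟩ := exists_forall_Ici_hasDerivWithinAt hC hB t₀ ζ₀
  have hζc : ContinuousOn ζ (Ici t₀) := fun t ht => (hζ t ht).continuousWithinAt
  have hVc : ContinuousOn (fun t => lyapunov e (ζ t)) (Ici t₀) := by
    unfold lyapunov; fun_prop
  have hVd : ∀ t ∈ Ici t₀, |‖ζ t‖ ^ 2 - 1| ≤ δ →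
      HasDerivWithinAt (fun τ => lyapunov e (ζ τ))
        (lyapunovRate lam mu e (ζ t) * lyapunov e (ζ t)) (Ici t₀) t := fun t ht hδt =>
    hasDerivWithinAt_lyapunov he0 (hgt _ hδt) (hg (show ζ t ∈ {ζ : ℂ | _} from hδt) ▸ hζ t ht)
  have hstart : |‖ζ t₀‖ ^ 2 - 1| < δ := by rw [hζ0]; refine hζ₀.trans_le ?_; nlinarith
  have htrap : ∀ t ∈ Ici t₀, |‖ζ t‖ ^ 2 - 1| ≤ δ := by
    intro t ht
    by_contra! hcon
    obtain ⟨T, hT, hTδ, hlt⟩ := exists_first_exit (φ := fun t => |‖ζ t‖ ^ 2 - 1|) (by fun_prop)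
      hstart ht hcon.le
    have hanti := antitoneOn_of_hasDerivWithinAt_Ici (convex_Icc t₀ T) Icc_subset_Ici_self
      (hVc.mono Icc_subset_Ici_self)
      (fun s hs => by
        rw [interior_Icc] at hs
        exact hVd s hs.1.le (hlt s ⟨hs.1.le, hs.2⟩).le)
      (fun s hs => by
        rw [interior_Icc] at hs
        have := (hrate _ ((hlt s ⟨hs.1.le, hs.2⟩).le.trans hle)).2
        exact mul_nonpos_of_nonpos_of_nonneg (by linarith) (lyapunov_nonneg _ _))
      ⟨le_rfl, hT.le⟩ ⟨hT.le, le_rfl⟩ hT.le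
    -- At the first exit `m²δ² ≤ V(T) ≤ V(t₀) ≤ 9(|ζ₀|²-1)² < m²δ²`, a contradiction.
    have hT1 : |‖ζ T‖ ^ 2 - 1| ≤ δ := hTδ.le
    have l1 := sq_mul_le_lyapunov he0 he1 (hrate _ (hT1.trans hle)).1 (by linarith)
    have l2 := lyapunov_le_sq_mul he0 he1 (hrate _ (hstart.le.trans hle)).1 (by linarith)
    have l3 : (‖ζ T‖ ^ 2 - 1) ^ 2 = δ ^ 2 := by rw [← sq_abs, hTδ]
    have l4 : (‖ζ t₀‖ ^ 2 - 1) ^ 2 < (δ * m / 3) ^ 2 := by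
      rw [← sq_abs, hζ0]; exact pow_lt_pow_left₀ hζ₀ (abs_nonneg _) two_ne_zero
    rw [l3, ← hmdef] at l1
    change lyapunov e (ζ T) ≤ lyapunov e (ζ t₀) at hanti
    nlinarith
  refine ⟨ζ, hζ0, fun t ht => ⟨hg (show ζ t ∈ {ζ : ℂ | _} from htrap t ht) ▸ hζ t ht,
    hgt _ (htrap t ht), htrap t ht⟩, ?_⟩
  -- Since `V' ≤ -κV`, the product `V exp(κt)` does not increase.
  have hdecay : AntitoneOn (fun t => lyapunov e (ζ t) * Real.exp (κ * t)) (Ici t₀) := by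
    refine antitoneOn_of_hasDerivWithinAt_Ici (convex_Ici t₀) subset_rfl
      (hVc.mul (by fun_prop)) (fun t ht => ?_) (fun t ht => ?_)
      (φ' := fun t => (lyapunovRate lam mu e (ζ t) + κ) * lyapunov e (ζ t) * Real.exp (κ * t))
    · have ht' : t ∈ Ici t₀ := interior_subset ht
      have he : HasDerivWithinAt (fun t => Real.exp (κ * t)) (Real.exp (κ * t) * (κ * 1))
          (Ici t₀) t := ((hasDerivAt_id t).const_mul κ).exp.hasDerivWithinAt
      refine ((hVd t ht' (htrap t ht')).mul he).congr_deriv ?_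
      ring
    · have := (hrate _ ((htrap t (interior_subset ht)).trans hle)).2
      exact mul_nonpos_of_nonpos_of_nonneg
        (mul_nonpos_of_nonpos_of_nonneg (by linarith) (lyapunov_nonneg _ _)) (Real.exp_pos _).le
  set A := lyapunov e (ζ t₀) * Real.exp (κ * t₀) with hA
  have hlim : Tendsto (fun t => A / m ^ 2 * Real.exp (-(κ * t))) atTop (𝓝 0) := by
    have : Tendsto (fun t => Real.exp (-(κ * t))) atTop (𝓝 0) :=
      Real.tendsto_exp_neg_atTop_nhds_zero.comp (tendsto_id.const_mul_atTop hκ)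
    simpa using this.const_mul (A / m ^ 2)
  have hsq : Tendsto (fun t => (‖ζ t‖ ^ 2 - 1) ^ 2) atTop (𝓝 0) := by
    refine squeeze_zero' (Eventually.of_forall fun t => sq_nonneg _) ?_ hlim
    filter_upwards [eventually_ge_atTop t₀] with t ht
    have l1 := sq_mul_le_lyapunov he0 he1 (hrate _ ((htrap t ht).trans hle)).1
      ((htrap t ht).trans (by linarith))
    have l2 : lyapunov e (ζ t) * Real.exp (κ * t) ≤ A :=
      hdecay (mem_Ici.2 le_rfl) ht ht
    have hpos := Real.exp_pos (κ * t)
    rw [← hmdef] at l1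
    rw [Real.exp_neg, ← div_eq_mul_inv, div_div, le_div_iff₀ (by positivity)]
    nlinarith [mul_le_mul_of_nonneg_right l1 hpos.le]
  have habs := hsq.sqrt
  simp only [Real.sqrt_sq_eq_abs, Real.sqrt_zero] at habs
  have := (tendsto_zero_iff_abs_tendsto_zero _).2 habs
  simpa using this.add_const 1

/-! ### Regularity of the drift on the phase space. -/

lemma isOpen_kepDomain (lam mu e : ℝ) : IsOpen (kepDomain lam mu e) := by
  have h0 : Continuous fun p : Plane => p 0 := by fun_prop
  have h1 : Continuous fun p : Plane => p 1 := by fun_prop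
  exact ((isClosed_eq h1 continuous_const).inter ((isClosed_le continuous_const h0).inter
    (isClosed_le h0 continuous_const))).isOpen_compl

lemma contDiffAt_norm_coords {p : Plane} (h : p 0 ^ 2 + p 1 ^ 2 ≠ 0) :
    ContDiffAt ℝ 1 (fun p : Plane => √(p 0 ^ 2 + p 1 ^ 2)) p :=
  ContDiffAt.sqrt (by fun_prop) h

/-- Smoothness can fail only where a denominator or radicand vanishes. But `D = |w|²`, the inner
numerator is `|w - 4ae|² = |Z²w|²`, and the outer radicand is nonzero as `α > 0`; none vanishes off
the segment. -/
lemma contDiffAt_kepAlpha_kepBeta (hlam : 0 < lam) (hmu : 0 < mu) (he0 : 0 < e) (he1 : e < 1)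
    {p : Plane} (hp : p ∈ kepDomain lam mu e) :
    p 0 ^ 2 + p 1 ^ 2 ≠ 0 ∧ ContDiffAt ℝ 1 (fun p : Plane => kepAlpha lam mu e (p 0) (p 1)) p ∧
      ContDiffAt ℝ 1 (fun p : Plane => kepBeta lam mu e (p 0) (p 1)) p := by
  have ha := kepA_pos hlam hmu
  have h1 := one_sub_sq_pos he0 he1
  have hs : √(1 - e ^ 2) ^ 2 = 1 - e ^ 2 := Real.sq_sqrt h1.le
  obtain ⟨hw, hre, hZ⟩ := kepZ_spec hmu he0 he1 ha hp
  have hα : kepAlpha lam mu e (p 0) (p 1) ≠ 0 := hre.ne'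
  have hr : p 0 ^ 2 + p 1 ^ 2 ≠ 0 := by
    intro h
    have h0 : p 0 = 0 := by nlinarith [sq_nonneg (p 0), sq_nonneg (p 1)]
    have h0' : p 1 = 0 := by nlinarith [sq_nonneg (p 0), sq_nonneg (p 1)]
    exact hw (by simp [focalCoord, h0, h0']; rfl)
  have hD : kepDen e (p 0) (p 1) ≠ 0 := by
    have : kepDen e (p 0) (p 1) = ‖focalCoord e p‖ ^ 2 := by
      rw [norm_sq_eq_re_im, kepDen, ← hs]; simp only [focalCoord]; ring
    rw [this]
    exact pow_ne_zero 2 (norm_ne_zero_iff.2 hw)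
  have hN : (e * √(p 0 ^ 2 + p 1 ^ 2) - p 0 - 4 * lam ^ 2 * e / mu) ^ 2
      + (1 - e ^ 2) * p 1 ^ 2 ≠ 0 := by
    have : (e * √(p 0 ^ 2 + p 1 ^ 2) - p 0 - 4 * lam ^ 2 * e / mu) ^ 2
      + (1 - e ^ 2) * p 1 ^ 2 = ‖focalCoord e p - 4 * kepA lam mu * e‖ ^ 2 := by
      have hc : (4 * kepA lam mu * e : ℂ) = ((4 * lam ^ 2 * e / mu : ℝ) : ℂ) := by
        rw [kepA]; push_cast; ring
      rw [norm_sq_eq_re_im, ← hs, hc, Complex.sub_re, Complex.sub_im, Complex.ofReal_re,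
        Complex.ofReal_im]
      simp only [focalCoord]
      ring
    rw [this, ← hZ]
    refine pow_ne_zero 2 (norm_ne_zero_iff.2 (mul_ne_zero (pow_ne_zero 2 fun h => ?_) hw))
    rw [h] at hre
    exact lt_irrefl _ hre
  have d := contDiffAt_norm_coords hr
  have dD : ContDiffAt ℝ 1 (fun p : Plane => kepDen e (p 0) (p 1)) p := by
    unfold kepDen; fun_prop
  have dN : ContDiffAt ℝ 1 (fun p : Plane => √(((e * √(p 0 ^ 2 + p 1 ^ 2) - p 0
      - 4 * lam ^ 2 * e / mu) ^ 2 + (1 - e ^ 2) * p 1 ^ 2) / kepDen e (p 0) (p 1))) p :=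
    ContDiffAt.sqrt (ContDiffAt.div (by fun_prop) dD hD) (div_ne_zero hN hD)
  have dM : ContDiffAt ℝ 1 (fun p : Plane => ((e * √(p 0 ^ 2 + p 1 ^ 2) - p 0
      - 2 * lam ^ 2 * e / mu) ^ 2 + (1 - e ^ 2) * p 1 ^ 2 - 4 * lam ^ 4 * e ^ 2 / mu ^ 2)
        / kepDen e (p 0) (p 1)) p :=
    ContDiffAt.div (by fun_prop) dD hD
  have dα : ContDiffAt ℝ 1 (fun p : Plane => kepAlpha lam mu e (p 0) (p 1)) p :=
    ContDiffAt.sqrt ((contDiffAt_const.mul dN).add (contDiffAt_const.mul dM))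
      fun h => hα (by rw [kepAlpha, h, Real.sqrt_zero])
  refine ⟨hr, dα, ?_⟩
  exact ContDiffAt.div (by fun_prop) ((contDiffAt_const.mul dD).mul dα)
    (mul_ne_zero (mul_ne_zero hmu.ne' hD) hα)

lemma contDiffOn_kepDrift (hlam : 0 < lam) (hmu : 0 < mu) (he0 : 0 < e) (he1 : e < 1) :
    ContDiffOn ℝ 1 (kepDrift lam mu e) (kepDomain lam mu e) := by
  intro p hp
  apply ContDiffAt.contDiffWithinAt
  obtain ⟨hr, dα, dβ⟩ := contDiffAt_kepAlpha_kepBeta hlam hmu he0 he1 hp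
  have d := contDiffAt_norm_coords hr
  have hr' : √(p 0 ^ 2 + p 1 ^ 2) ≠ 0 :=
    (Real.sqrt_pos.2 (lt_of_le_of_ne (by positivity) hr.symm)).ne'
  have d0 : ContDiffAt ℝ 1 (fun p : Plane => p 0 / √(p 0 ^ 2 + p 1 ^ 2)) p :=
    ContDiffAt.div (by fun_prop) d hr'
  have d1 : ContDiffAt ℝ 1 (fun p : Plane => p 1 / √(p 0 ^ 2 + p 1 ^ 2)) p :=
    ContDiffAt.div (by fun_prop) d hr'
  rw [contDiffAt_euclidean]
  intro i
  fin_cases i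
  · change ContDiffAt ℝ 1 (fun p : Plane => kepDriftX lam mu e (p 0) (p 1)) p
    unfold kepDriftX
    fun_prop
  · change ContDiffAt ℝ 1 (fun p : Plane => kepDriftY lam mu e (p 0) (p 1)) p
    unfold kepDriftY
    fun_prop

lemma continuousAt_anomaly (hlam : 0 < lam) (hmu : 0 < mu) (he0 : 0 < e) (he1 : e < 1)
    {p : Plane} (hp : p ∈ kepDomain lam mu e) : ContinuousAt (anomaly lam mu e) p := by
  obtain ⟨-, dα, dβ⟩ := contDiffAt_kepAlpha_kepBeta hlam hmu he0 he1 hp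
  have hZ : ContinuousAt (kepZ lam mu e) p := by
    have : kepZ lam mu e = fun p : Plane => ((kepAlpha lam mu e (p 0) (p 1) : ℝ) : ℂ)
        + (kepBeta lam mu e (p 0) (p 1) : ℝ) * Complex.I := by
      funext p
      exact Complex.mk_eq_add_mul_I _ _
    rw [this]
    exact (Complex.continuous_ofReal.continuousAt.comp dα.continuousAt).add
      ((Complex.continuous_ofReal.continuousAt.comp dβ.continuousAt).mul continuousAt_const)
  exact (continuousAt_const.mul (hZ.add continuousAt_const)).div (hZ.sub continuousAt_const)
    (kepZ_ne_one hlam hmu he0 he1 hp)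

lemma continuousAt_ofAnomaly {a : ℝ} {ζ : ℂ} (he0 : 0 < e)
    (h : e < ‖ζ‖) : ContinuousAt (ofAnomaly a e) ζ := by
  have hw := (contDiffAt_joukowski a he0 h).continuousAt
  have : Continuous (ofFocal e) := by
    unfold ofFocal focalRadius
    fun_prop
  exact this.continuousAt.comp hw

/-! ### The Kepler ellipse as the unit circle, and its periodic motion. -/

lemma joukowski_of_norm_eq_one {a : ℝ} {ζ : ℂ} (h : ‖ζ‖ = 1) :
    joukowski a e ζ = ⟨a * (2 * e - (1 + e ^ 2) * ζ.re), -(a * (1 - e ^ 2) * ζ.im)⟩ := by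
  have h0 : ζ ≠ 0 := norm_ne_zero_iff.1 (by rw [h]; exact one_ne_zero)
  have hN := norm_sq_eq_re_im ζ
  rw [h] at hN
  rw [joukowski, div_eq_iff h0]
  apply Complex.ext
  · simp [pow_two]
    linear_combination -a * e ^ 2 * hN
  · simp [pow_two]
    ring

lemma focalRadius_of_norm_eq_one {a : ℝ} {ζ : ℂ} (ha : 0 < a) (he0 : 0 < e) (he1 : e < 1)
    (h : ‖ζ‖ = 1) : focalRadius e (joukowski a e ζ) = a * (1 - e * ζ.re) := by
  have hN := norm_sq_eq_re_im ζ
  rw [h] at hN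
  have h1 := one_sub_sq_pos he0 he1
  have hre := h ▸ Complex.re_le_norm ζ
  have hn : ‖joukowski a e ζ‖ = a * (1 + e ^ 2 - 2 * e * ζ.re) := by
    have hpos : 0 ≤ a * (1 + e ^ 2 - 2 * e * ζ.re) := mul_nonneg ha.le (by nlinarith [sq_nonneg (1 - e)])
    rw [← abs_of_nonneg (norm_nonneg _), ← abs_of_nonneg hpos, ← sq_eq_sq_iff_abs_eq_abs,
      norm_sq_eq_re_im, joukowski_of_norm_eq_one h]
    linear_combination -a ^ 2 * (1 - e ^ 2) ^ 2 * hN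
  rw [focalRadius, hn, joukowski_of_norm_eq_one h, div_eq_iff h1.ne']
  ring

lemma ofAnomaly_of_norm_eq_one {a : ℝ} {ζ : ℂ} (ha : 0 < a) (he0 : 0 < e) (he1 : e < 1)
    (h : ‖ζ‖ = 1) : ofAnomaly a e ζ = !₂[a * (ζ.re - e), a * √(1 - e ^ 2) * ζ.im] := by
  have h1 := one_sub_sq_pos he0 he1
  have hs := (Real.sqrt_pos.2 h1).ne'
  have hs2 : √(1 - e ^ 2) ^ 2 = 1 - e ^ 2 := Real.sq_sqrt h1.le
  rw [ofAnomaly, ofFocal, focalRadius_of_norm_eq_one ha he0 he1 h, joukowski_of_norm_eq_one h]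
  congr 2
  · ring
  · congr 1
    rw [neg_neg, div_eq_iff hs]
    linear_combination -a * ζ.im * hs2

lemma keplerEllipse_eq_image (hlam : 0 < lam) (hmu : 0 < mu) (he0 : 0 < e) (he1 : e < 1) :
    keplerEllipse lam mu e = ofAnomaly (kepA lam mu) e '' {ζ | ‖ζ‖ = 1} := by
  have ha := kepA_pos hlam hmu
  have h1 := one_sub_sq_pos he0 he1
  have hs2 : √(1 - e ^ 2) ^ 2 = 1 - e ^ 2 := Real.sq_sqrt h1.le
  set a := kepA lam mu
  ext p
  constructor
  · rintro ⟨r, θ, hr, rfl⟩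
    replace hr : r = a * (1 - e ^ 2) / (1 + e * Real.cos θ) := hr
    have hd : 0 < 1 + e * Real.cos θ := by nlinarith [Real.neg_one_le_cos θ]
    have hcs := Real.sin_sq_add_cos_sq θ
    -- The classical passage from the true anomaly `θ` to the eccentric anomaly.
    have hnorm : ‖(⟨(e + Real.cos θ) / (1 + e * Real.cos θ),
        √(1 - e ^ 2) * Real.sin θ / (1 + e * Real.cos θ)⟩ : ℂ)‖ = 1 := by
      rw [← pow_eq_one_iff_of_nonneg (norm_nonneg _) two_ne_zero, norm_sq_eq_re_im]
      simp only [div_pow, mul_pow, hs2]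
      field_simp
      linear_combination (1 - e ^ 2) * hcs
    refine ⟨_, hnorm, ?_⟩
    rw [ofAnomaly_of_norm_eq_one ha he0 he1 hnorm, hr]
    congr 2
    · field_simp
      ring
    · congr 1
      field_simp
      rw [hs2]
  · rintro ⟨ζ, hζ, rfl⟩
    have hζ' : ‖ζ‖ = 1 := hζ
    have hN := norm_sq_eq_re_im ζ
    rw [hζ'] at hN
    have hre := hζ' ▸ Complex.re_le_norm ζ
    have hR : 0 < 1 - e * ζ.re := by nlinarith
    -- `q` is the position divided by `a`; its modulus is `r/a` and its argument the true anomaly.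
    set q : ℂ := ⟨ζ.re - e, √(1 - e ^ 2) * ζ.im⟩ with hq
    have hnq : ‖q‖ = 1 - e * ζ.re := by
      rw [← abs_of_nonneg (norm_nonneg _), ← abs_of_pos hR, ← sq_eq_sq_iff_abs_eq_abs,
        norm_sq_eq_re_im, hq]
      simp only [mul_pow, hs2]
      linear_combination (e ^ 2 - 1) * hN
    have hc : (1 - e * ζ.re) * Real.cos q.arg = ζ.re - e := by
      rw [← hnq, Complex.norm_mul_cos_arg]
    have hsn : (1 - e * ζ.re) * Real.sin q.arg = √(1 - e ^ 2) * ζ.im := by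
      rw [← hnq, Complex.norm_mul_sin_arg]
    refine ⟨a * (1 - e * ζ.re), q.arg, ?_, ?_⟩
    · have hd : 0 < 1 + e * Real.cos q.arg := by nlinarith [Real.neg_one_le_cos q.arg]
      rw [eq_div_iff hd.ne']
      linear_combination a * e * hc
    · rw [ofAnomaly_of_norm_eq_one ha he0 he1 hζ',
        mul_assoc a _ (Real.cos _), mul_assoc a _ (Real.sin _), hc, hsn, ← mul_assoc]

/-- Kepler's equation `E - e sin E = t` has a smooth solution. -/
lemma exists_kepler_equation (he0 : 0 < e) (he1 : e < 1) :
    ∃ E : ℝ → ℝ, (∀ t, E t - e * Real.sin (E t) = t) ∧ (∀ x, E (x - e * Real.sin x) = x) ∧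
      ∀ t, HasDerivAt E (1 - e * Real.cos (E t))⁻¹ t := by
  have hd : ∀ x, HasDerivAt (fun x => x - e * Real.sin x) (1 - e * Real.cos x) x := fun x =>
    (hasDerivAt_id x).sub ((Real.hasDerivAt_sin x).const_mul e)
  have hpos : ∀ x, 0 < 1 - e * Real.cos x := fun x => by nlinarith [Real.cos_le_one x]
  have hmono : StrictMono fun x => x - e * Real.sin x :=
    strictMono_of_deriv_pos fun x => by rw [(hd x).deriv]; exact hpos x
  have hcont : Continuous fun x => x - e * Real.sin x := by fun_prop
  -- As `e < 1`, the function stays within distance `1` of the identity.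
  have hsurj : Function.Surjective fun x => x - e * Real.sin x := by
    refine hcont.surjective ?_ ?_
    · refine tendsto_atTop_mono (fun x => ?_) (tendsto_atTop_add_const_right atTop (-1) tendsto_id)
      simp only [id]
      nlinarith [Real.sin_le_one x]
    · refine tendsto_atBot_mono (fun x => ?_) (tendsto_atBot_add_const_right atBot 1 tendsto_id)
      simp only [id]
      nlinarith [Real.neg_one_le_sin x]
  let Φ := hmono.orderIsoOfSurjective _ hsurj
  have h1 : ∀ t, Φ.symm t - e * Real.sin (Φ.symm t) = t := fun t => Φ.apply_symm_apply t
  refine ⟨Φ.symm, h1, fun x => Φ.symm_apply_apply x, fun t => ?_⟩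
  exact HasDerivAt.of_local_left_inverse Φ.symm.continuous.continuousAt (hd _) (hpos _).ne'
    (Eventually.of_forall h1)

lemma isPeriodicOrbit_keplerEllipse (hlam : 0 < lam) (hmu : 0 < mu) (he0 : 0 < e) (he1 : e < 1) :
    IsPeriodicOrbit (kepDrift lam mu e) (kepDomain lam mu e) (keplerEllipse lam mu e) := by
  have ha := kepA_pos hlam hmu
  obtain ⟨E, hE1, hE2, hEd⟩ := exists_kepler_equation he0 he1
  -- The mean motion: `ωt` is the mean anomaly, so the period is `2π/ω`.
  set ω := mu / lam / kepA lam mu with hω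
  have hω0 : 0 < ω := by positivity
  set ζ : ℝ → ℂ := fun t => Complex.exp (E (ω * t) * Complex.I) with hζ
  have hnorm : ∀ t, ‖ζ t‖ = 1 := fun t => Complex.norm_exp_ofReal_mul_I _
  have hlt : ∀ t, e < ‖ζ t‖ := fun t => by rwa [hnorm t]
  have hre : ∀ t, (ζ t).re = Real.cos (E (ω * t)) := fun t => Complex.exp_ofReal_mul_I_re _
  have hpos : ∀ x, 0 < 1 - e * Real.cos x := fun x => by nlinarith [Real.cos_le_one x]
  have hdζ : ∀ t, HasDerivAt ζ (anomalyField lam mu e (ζ t)) t := by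
    intro t
    have d1 : HasDerivAt (fun t => E (ω * t)) ((1 - e * Real.cos (E (ω * t)))⁻¹ * (ω * 1)) t :=
      (hEd (ω * t)).comp t ((hasDerivAt_id t).const_mul ω)
    refine (d1.ofReal_comp.mul_const Complex.I).cexp.congr_deriv ?_
    rw [anomalyField, focalRadius_of_norm_eq_one ha he0 he1 (hnorm t), hnorm t, hre t]
    have h1 : ((1 - e * Real.cos (E (ω * t)))⁻¹ * (ω * 1) : ℝ)
        = mu / lam / (kepA lam mu * (1 - e * Real.cos (E (ω * t)))) := by
      rw [hω]
      have := (hpos (E (ω * t))).ne'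
      field_simp
    rw [h1]
    simp only [inv_one, sub_self, Complex.ofReal_zero, mul_zero, zero_mul, add_zero, hζ]
    ring
  refine ⟨fun t => ofAnomaly (kepA lam mu) e (ζ t), ⟨fun t _ => ⟨?_, ?_⟩, ?_, ?_, ?_⟩⟩
  · exact ofAnomaly_mem hlam hmu he0 he1 (hlt t)
  · exact hasDerivWithinAt_ofAnomaly hlam hmu he0 he1 (hlt t) (hdζ t).hasDerivWithinAt
  · refine ⟨2 * Real.pi / ω, by positivity, fun t => ?_⟩
    have hper : E (ω * (t + 2 * Real.pi / ω)) = E (ω * t) + 2 * Real.pi := by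
      rw [← hE2 (E (ω * t) + 2 * Real.pi), Real.sin_add_two_pi]
      congr 1
      rw [mul_add, mul_div_cancel₀ _ hω0.ne']
      linear_combination -hE1 (ω * t)
    have : ζ (t + 2 * Real.pi / ω) = ζ t := by
      simp only [hζ, hper]
      push_cast
      rw [add_mul, Complex.exp_add, Complex.exp_two_pi_mul_I, mul_one]
    simp only [this]
  -- The times at which `E = 0` and `E = π`, the two apsides, whose abscissas differ.
  · refine ⟨(0 - e * Real.sin 0) / ω, (Real.pi - e * Real.sin Real.pi) / ω, fun h => ?_⟩
    have h0 := congrArg (fun p : Plane => p 0) h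
    simp only [ofAnomaly_of_norm_eq_one ha he0 he1 (hnorm _), hre,
      mul_div_cancel₀ _ hω0.ne', hE2, Real.cos_zero, Real.cos_pi] at h0
    simp at h0
    rcases h0 with h0 | h0 <;> linarith
  · rw [keplerEllipse_eq_image hlam hmu he0 he1]
    refine Subset.antisymm ?_ ?_
    · rintro _ ⟨t, rfl⟩
      exact mem_image_of_mem _ (hnorm t)
    · rintro _ ⟨z, hz, rfl⟩
      refine ⟨(z.arg - e * Real.sin z.arg) / ω, ?_⟩
      have : ζ ((z.arg - e * Real.sin z.arg) / ω) = z := by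
        simp only [hζ, mul_div_cancel₀ _ hω0.ne', hE2]
        have h := Complex.norm_mul_exp_arg_mul_I z
        rwa [show ‖z‖ = 1 from hz, Complex.ofReal_one, one_mul] at h
      simp only [this]

/-! ### Back to the plane. -/

/-- Trajectories that start near the Kepler ellipse stay near it and converge to it. -/
lemma exists_trajectory_near (hlam : 0 < lam) (hmu : 0 < mu) (he0 : 0 < e) (he1 : e < 1)
    {δ₁ : ℝ} (hδ₁ : 0 < δ₁) (t₀ : ℝ) {x₀ : Plane} (hx₀ : x₀ ∈ keplerEllipse lam mu e) :
    ∃ δ₂ : ℝ, 0 < δ₂ ∧ ∀ x₁ : Plane, ‖x₁ - x₀‖ < δ₂ →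
      ∃ x : ℝ → Plane, IsTrajectory (kepDrift lam mu e) (kepDomain lam mu e) t₀ x₁ x ∧
        (∀ t : ℝ, t₀ < t → Metric.infDist (x t) (keplerEllipse lam mu e) < δ₁) ∧
        Tendsto (fun t => Metric.infDist (x t) (keplerEllipse lam mu e)) atTop (𝓝 0) := by
  set C := keplerEllipse lam mu e with hC
  set Φ := ofAnomaly (kepA lam mu) e with hΦ
  have hnear : ∀ ε : ℝ, 0 < ε → ∃ δ : ℝ, 0 < δ ∧ ∀ ζ : ℂ, |‖ζ‖ ^ 2 - 1| ≤ δ →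
      Metric.infDist (Φ ζ) C < ε := by
    intro ε hε
    have hcont : ContinuousOn (fun ζ => Metric.infDist (Φ ζ) C) {ζ : ℂ | e < ‖ζ‖} := fun ζ hζ =>
      ((Metric.continuous_infDist_pt C).continuousAt.comp
        (continuousAt_ofAnomaly he0 hζ)).continuousWithinAt
    obtain ⟨δ, hδ, -, h⟩ := exists_annulus_subset
      (hcont.isOpen_inter_preimage (isOpen_lt_norm e) (isOpen_Iio (a := ε))) fun ζ hζ =>
        ⟨show e < ‖ζ‖ by rwa [hζ], show Metric.infDist (Φ ζ) C < ε by
          rwa [Metric.infDist_zero_of_mem]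
          rw [hC, keplerEllipse_eq_image hlam hmu he0 he1]
          exact mem_image_of_mem _ hζ⟩
    exact ⟨δ, hδ, fun ζ hζ => (h ζ hζ).2⟩
  rw [hC, keplerEllipse_eq_image hlam hmu he0 he1] at hx₀
  obtain ⟨ζ₀, hζ₀, rfl⟩ := hx₀
  have hζ₀' : ‖ζ₀‖ = 1 := hζ₀
  have hlt₀ : e < ‖ζ₀‖ := by rwa [hζ₀']
  obtain ⟨δ₀, hδ₀, hsol⟩ := exists_anomaly_solution hlam hmu he0 he1
  obtain ⟨δ, hδ, hδn⟩ := hnear δ₁ hδ₁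
  obtain ⟨η, hη, hsol⟩ := hsol (min δ δ₀) (lt_min hδ hδ₀) (min_le_right _ _)
  have hmem := ofAnomaly_mem hlam hmu he0 he1 hlt₀
  have hcont : ContinuousAt (fun p => |‖anomaly lam mu e p‖ ^ 2 - 1|) (Φ ζ₀) := by
    have := continuousAt_anomaly hlam hmu he0 he1 hmem
    fun_prop
  have hval : |‖anomaly lam mu e (Φ ζ₀)‖ ^ 2 - 1| < η := by
    rw [hΦ, anomaly_ofAnomaly hlam hmu he0 he1 hlt₀, hζ₀']
    simpa using hη
  obtain ⟨δ₂, hδ₂, hball⟩ := Metric.eventually_nhds_iff.1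
    ((hcont.eventually_lt continuousAt_const hval).and ((isOpen_kepDomain lam mu e).mem_nhds hmem))
  refine ⟨δ₂, hδ₂, fun x₁ hx₁ => ?_⟩
  obtain ⟨h1, h2⟩ := hball (by rwa [dist_eq_norm])
  obtain ⟨ζ, hζ0, hζ, hlim⟩ := hsol t₀ _ h1
  have htraj : IsSolutionOn (kepDrift lam mu e) (kepDomain lam mu e) (Ici t₀)
      fun t => Φ (ζ t) := fun t ht =>
    ⟨ofAnomaly_mem hlam hmu he0 he1 (hζ t ht).2.1,
      hasDerivWithinAt_ofAnomaly hlam hmu he0 he1 (hζ t ht).2.1 (hζ t ht).1⟩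
  have htr := htraj.isTrajectory (isOpen_kepDomain lam mu e)
    (contDiffOn_kepDrift hlam hmu he0 he1)
  rw [hζ0, hΦ, ofAnomaly_anomaly hlam hmu he0 he1 h2] at htr
  refine ⟨_, htr, fun t ht => hδn _ ((hζ t ht.le).2.2.trans (min_le_left _ _)), ?_⟩
  rw [Metric.tendsto_nhds]
  intro ε hε
  obtain ⟨δ', hδ', hn⟩ := hnear ε hε
  filter_upwards [Metric.tendsto_nhds.1 hlim δ' hδ'] with t ht
  rw [Real.dist_eq, sub_zero, abs_of_nonneg Metric.infDist_nonneg]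
  exact hn _ (by rw [← Real.dist_eq]; exact ht.le)

end

end

theorem mainTheorem3 (lam mu e : ℝ) (hlam : 0 < lam) (hmu : 0 < mu) (he0 : 0 < e) (he1 : e < 1) :
    IsPeriodicOrbit (kepDrift lam mu e) (kepDomain lam mu e) (keplerEllipse lam mu e) ∧
    IsAsymptoticallyOrbitallyStable (kepDrift lam mu e) (kepDomain lam mu e)
      (keplerEllipse lam mu e) := by
  have hmem : ∀ (t₀ : ℝ) (x₀ : Plane), (∃ p : ℝ → Plane, IsPeriodicSolutionTraversing
      (kepDrift lam mu e) (kepDomain lam mu e) (keplerEllipse lam mu e) p ∧ p t₀ = x₀) →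
      x₀ ∈ keplerEllipse lam mu e := by
    rintro t₀ _ ⟨p, hp, rfl⟩
    exact hp.range_eq ▸ mem_range_self t₀
  refine ⟨isPeriodicOrbit_keplerEllipse hlam hmu he0 he1, fun δ₁ hδ₁ t₀ x₀ hx₀ => ?_,
    fun t₀ x₀ hx₀ => ?_⟩
  · obtain ⟨δ₂, hδ₂, h⟩ := exists_trajectory_near hlam hmu he0 he1 hδ₁ t₀ (hmem t₀ x₀ hx₀)
    refine ⟨δ₂, hδ₂, fun x₁ hx₁ => ?_⟩
    obtain ⟨x, hx, hx', -⟩ := h x₁ hx₁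
    exact ⟨x, hx, hx'⟩
  -- The limit does not involve the tolerance; the value `1` is arbitrary.
  · obtain ⟨δ₂, hδ₂, h⟩ := exists_trajectory_near hlam hmu he0 he1 one_pos t₀ (hmem t₀ x₀ hx₀)
    refine ⟨δ₂, hδ₂, fun x₁ hx₁ => ?_⟩
    obtain ⟨x, hx, -, hx'⟩ := h x₁ hx₁
    exact ⟨x, hx, hx'⟩
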